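/- Let $\mathbb{K}$ be a non-archimedean local field with residue field of cardinality $q$, ring of integers $\mathcal{O}_{\mathbb K}$, prime ideal $\mathfrak p$, and normalized absolute value $|\cdot|_{\mathbb K}$ (a uniformizer has absolute value $q^{-1}$). Let $\mathfrak g=\bigoplus_{k\ge 1}V_k$, $[V_i,V_j]\subseteq V_{i+j}$, be a finite-dimensional graded (hence nilpotent) $\mathbb K$-Lie algebra with homogeneous dimension $Q=\sum_k k\dim V_k$; if $c$ is its nilpotency class, assume $c!\neq 0$ in $\mathbb K$ (automatic in characteristic $0$). Let $G=\exp(\mathfrak g)$ be the corresponding graded $\mathbb K$-Lie group: $\exp:\mathfrak g\to G$ is a homeomorphism and $\exp X\exp Y=\exp(X\diamond Y)$ with $\diamond$ the Baker–Campbell–Hausdorff product. For $\gamma\in\mathbb K^*$ let $D_\gamma$ be multiplication by $\gamma^k$ on $V_k$, and write $\gamma x=\exp(D_\gamma\exp^{-1}x)$ for $x\in G$. Let $X_1,\dots,X_d$ be a basis of $\mathfrak g$ with $X_i\in V_{\nu_i}$, put $G_n=\exp(\mathfrak p^{n\nu_1}X_1+\dots+\mathfrak p^{n\nu_d}X_d)$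 for $n\in\mathbb Z$, let $dx$ be the Haar measure on $G$ with $|G_0|=1$, and set $|e|_G=0$, $|x|_G=|G_n|^{1/Q}$ for $x\in G_n\setminus G_{n+1}$, and $B(e,R)=\{y\in G:|y|_G\le R\}$. Let $1<r\le s<\infty$, $\frac1r+\frac1{r'}=1$, $\alpha<Q$ and $\beta>Q/(r'-1)$. Let $\varphi,\psi:G\to[0,\infty)$ be continuous on $G\setminus\{e\}$ and homogeneous there of degrees $-\alpha$ and $\beta$, i.e. $\varphi(\gamma x)=|\gamma|_{\mathbb K}^{-\alpha}\varphi(x)$ and $\psi(\gamma x)=|\gamma|_{\mathbb K}^{\beta}\psi(x)$ for all $\gamma\in\mathbb K^*$, $x\ne e$. Assume that $\varphi$ is not identically zero on $G\setminus\{e\}$ and that $\int_{G_0\setminus G_1}\psi(x)^{1-r'}\,dx<\infty$ (with $0^{1-r'}=\infty$); the latter holds in particular if $\psi>0$ on $G\setminus\{e\}$. Then there is a finite constant $C\ge 0$ such that $$\Big(\int_G\Big(\int_{G\setminus B(e,|x|_G)}f(z)\,dz\Big)^s\varphi(x)\,dx\Big)^{1/s}\le C\Big(\int_G f(x)^r\,\psi(x)\,dx\Big)^{1/r}$$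 for every measurable function $f$ on $G$ with $f\ge 0$ a.e. (both sides taken in $[0,\infty]$), if and only if $$\frac{\alpha-Q}{s}=\frac{Q}{r'}-\frac{\beta}{r}.$$ -/

import Mathlib

open MeasureTheory

open scoped ENNReal NNReal

noncomputable section

namespace GradedHardy

/-! ### Non-archimedean local fields -/

/-- The cardinality `q` of the residue field of an ultrametric normed field `K`. -/
def residueCard (K : Type*) [NontriviallyNormedField K] [IsUltrametricDist K] : ℕ :=
  Nat.card (IsLocalRing.ResidueField (NormedField.valuation (K := K)).valuationSubring)

/-- The norm of `K` is the normalized absolute value of the local field: the largest value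
smaller than `1` (the value at a uniformizer) is `q⁻¹`. -/
def IsNormalizedAbs (K : Type*) [NontriviallyNormedField K] [IsUltrametricDist K] : Prop :=
  IsGreatest {t : ℝ | t < 1 ∧ ∃ x : K, ‖x‖ = t} (residueCard K : ℝ)⁻¹

/-! ### The Baker-Campbell-Hausdorff product of a nilpotent Lie algebra -/

/-- The right-nested bracket `[a₁, [a₂, [⋯, [aₘ₋₁, aₘ]⋯]]]`. -/
def nestedBracket {L : Type*} [LieRing L] : List L → L
  | [] => 0
  | [a] => a
  | a :: b :: l => ⁅a, nestedBracket (b :: l)⁆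

/-- The word `X^{r₁} Y^{s₁} ⋯ X^{rₙ} Y^{sₙ}`, as a list of letters. -/
def bchWord {L : Type*} (X Y : L) {n : ℕ} (e : Fin n → ℕ × ℕ) : List L :=
  (List.ofFn e).flatMap fun p => List.replicate p.1 X ++ List.replicate p.2 Y

/-- The Baker-Campbell-Hausdorff product `X ⋄ Y = log (exp X exp Y)` in Dynkin's form
`∑ₙ (-1)^(n-1)/n ∑ [X^{r₁} Y^{s₁} ⋯ X^{rₙ} Y^{sₙ}] / (∑ᵢ (rᵢ + sᵢ) ∏ᵢ rᵢ! sᵢ!)`,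
the inner sum over all exponents with `rᵢ + sᵢ > 0`.  All brackets of more than `c` letters
vanish, `c` being the nilpotency class, so the sums may be cut off at `c`. -/
def bch (K : Type*) {L : Type*} [Field K] [LieRing L] [LieAlgebra K L] (X Y : L) : L :=
  ∑ n ∈ Finset.Icc 1 (LieModule.nilpotencyLength L L),
    ∑ e ∈ Fintype.piFinset (fun _ : Fin n =>
        (Finset.range (LieModule.nilpotencyLength L L + 1) ×ˢ
          Finset.range (LieModule.nilpotencyLength L L + 1)).erase (0, 0)),
      ((-1 : K) ^ (n - 1) / ((n : K) * ((∑ i, ((e i).1 + (e i).2) : ℕ) : K) *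
          ((∏ i, ((e i).1.factorial * (e i).2.factorial) : ℕ) : K))) •
        nestedBracket (bchWord X Y e)

/-! ### Graded Lie algebras and graded Lie groups -/

/-- A gradation `L = ⨁_{k ≥ 1} V k`, `[V i, V j] ⊆ V (i + j)`, of a Lie algebra.
For finite-dimensional `L` only finitely many `V k` are non-trivial, and `L` is nilpotent. -/
structure LieGradation (K L : Type*) [Field K] [LieRing L] [LieAlgebra K L] where
  V : ℕ → Submodule K L
  isInternal : DirectSum.IsInternal V
  V_zero : V 0 = ⊥
  lie_mem : ∀ i j : ℕ, ∀ X ∈ V i, ∀ Y ∈ V j, ⁅X, Y⁆ ∈ V (i + j)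

/-- The homogeneous dimension `Q = ∑ k · dim V k`. -/
def LieGradation.homDim {K L : Type*} [Field K] [LieRing L] [LieAlgebra K L]
    (S : LieGradation K L) : ℕ :=
  ∑ᶠ k : ℕ, k * Module.finrank K (S.V k)

theorem LieGradation.bijective {K L : Type*} [Field K] [LieRing L] [LieAlgebra K L]
    (S : LieGradation K L) : Function.Bijective (DirectSum.coeLinearMap S.V) :=
  S.isInternal

/-- The dilation `D_γ` of the Lie algebra: multiplication by `γ ^ k` on `V k`. -/
def LieGradation.dilation {K L : Type*} [Field K] [LieRing L] [LieAlgebra K L]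
    (S : LieGradation K L) (γ : K) : L →ₗ[K] L :=
  (DirectSum.toModule K ℕ L fun k => γ ^ k • (S.V k).subtype) ∘ₗ
    (LinearEquiv.ofBijective (DirectSum.coeLinearMap S.V) S.bijective).symm.toLinearMap

theorem LieGradation.dilation_of_mem {K L : Type*} [Field K] [LieRing L] [LieAlgebra K L]
    (S : LieGradation K L) (γ : K) {k : ℕ} {X : L} (hX : X ∈ S.V k) :
    S.dilation γ X = γ ^ k • X := by
  have h : (LinearEquiv.ofBijective (DirectSum.coeLinearMap S.V) S.bijective).symm X =
      DirectSum.lof K ℕ (fun k => S.V k) k ⟨X, hX⟩ := by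
    rw [LinearEquiv.symm_apply_eq, LinearEquiv.ofBijective_apply, DirectSum.coeLinearMap_lof]
  simp [LieGradation.dilation, h, DirectSum.toModule_lof]

/-- A graded `K`-Lie group `G` with Lie algebra `L`: `L` is a graded Lie algebra whose
nilpotency class `c` satisfies `c! ≠ 0` in `K` (automatic in characteristic zero), and `G` is
its exponential group, that is, `exp : L → G` is a homeomorphism and
`exp X * exp Y = exp (X ⋄ Y)` with `⋄` the Baker-Campbell-Hausdorff product. -/
structure GradedLieGroup (K L G : Type*) [Field K] [LieRing L] [LieAlgebra K L]
    [TopologicalSpace L] [Group G] [TopologicalSpace G] extends LieGradation K L where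
  factorial_ne_zero : ((LieModule.nilpotencyLength L L).factorial : K) ≠ 0
  exp : L ≃ₜ G
  exp_mul_exp : ∀ X Y : L, exp X * exp Y = exp (bch K X Y)

/-- A basis `X₁, …, X_d` of the Lie algebra made of eigenvectors of the dilations:
the vector `X_i` lies in `V (weight i)`. -/
structure AdaptedBasis {K L : Type*} [Field K] [LieRing L] [LieAlgebra K L]
    (S : LieGradation K L) (ι : Type*) where
  basis : Module.Basis ι K L
  weight : ι → ℕ
  mem : ∀ i, basis i ∈ S.V (weight i)

section

variable {K L G ι : Type*} [NontriviallyNormedField K] [IsUltrametricDist K] [LieRing L]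
  [LieAlgebra K L] [TopologicalSpace L] [Group G] [TopologicalSpace G]

/-- The dilation `γ x = exp (D_γ (exp⁻¹ x))` of the group. -/
def GradedLieGroup.dil (S : GradedLieGroup K L G) (γ : K) (x : G) : G :=
  S.exp (S.toLieGradation.dilation γ (S.exp.symm x))

/-- `φ` is homogeneous of degree `d`: `φ (γ x) = |γ|^d φ x` for all `γ ≠ 0` and `x ≠ e`. -/
def GradedLieGroup.IsHomogeneous (S : GradedLieGroup K L G) (φ : G → ℝ) (d : ℝ) : Prop :=
  ∀ γ : K, γ ≠ 0 → ∀ x : G, x ≠ 1 → φ (S.dil γ x) = ‖γ‖ ^ d * φ x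

/-- The set `G_n = exp (𝔭^{n ν₁} X₁ + ⋯ + 𝔭^{n ν_d} X_d)`, where `ν_i` is the weight of `X_i`
and `𝔭^m` is the ball of radius `q^{-m}` in `K`. -/
def filt (S : GradedLieGroup K L G) (b : AdaptedBasis S.toLieGradation ι) (n : ℤ) : Set G :=
  S.exp '' {X : L | ∀ i, ‖b.basis.repr X i‖ ≤ (residueCard K : ℝ) ^ (-(n * (b.weight i : ℤ)))}

variable [MeasurableSpace G]

open Classical in
/-- The homogeneous quasi-norm `|x|_G`, equal to `|G_n|^{1/Q}` for `x ∈ G_n ∖ G_{n+1}` and to `0`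
if there is no such `n`, that is, for `x = e`. -/
def gnorm (S : GradedLieGroup K L G) (b : AdaptedBasis S.toLieGradation ι) (μ : Measure G)
    (x : G) : ℝ :=
  if h : ∃ n : ℤ, x ∈ filt S b n \ filt S b (n + 1) then
    (μ (filt S b h.choose)).toReal ^ (1 / (S.toLieGradation.homDim : ℝ))
  else 0

/-- The ball `B(e, R)` of the quasi-norm. -/
def gball (S : GradedLieGroup K L G) (b : AdaptedBasis S.toLieGradation ι) (μ : Measure G)
    (R : ℝ) : Set G :=
  {y : G | gnorm S b μ y ≤ R}

end

end GradedHardy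

end

open GradedHardy

/-! Everything reduces to sequences indexed by `ℤ`. Up to the null set `{e}`, `G` is the disjoint
union of the shells `G_n ∖ G_{n+1}`, and `B(e, |x|) = G_n` for `x` in the `n`-th shell. With `F_m`
the integral of `f` over shell `m`, the `s`-th power of the left side is `∑ₙ (∑_{m<n} F_m)^s Φ_n`,
where `Φ_n` is the integral of `φ` over shell `n` (`lintegral_hardy_eq_tsum`). The dilation by `ϖ^n`
carries shell `0` onto shell `n` and multiplies volumes by `q^{-nQ}`, so the integral of a
homogeneous weight over shell `n` is geometric in `n` (`setLIntegral_shell`).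

Sufficiency: Hölder on each shell gives `F_m ≤ q^{mt} I^{1/r'} A_m^{1/r}`, with `A_m` the integral
of `f^r ψ` over shell `m`, while `Φ_n = q^{-nts} P`. The critical relation says precisely that the
same `t = (Q - α)/s` occurs in both. What remains is convolution with the kernel `q^{-jt}`, `j > 0`,
which is summable since `α < Q`; Young's inequality and `ℓ^r ⊆ ℓ^s` conclude (`tsum_hardy_le`).

Necessity: the indicator of shell `m`, tested for all `m`, bounds `q^{mδ}` uniformly in `m ∈ ℤ`, so
the defect `δ` of the relation is `0`.

The scaling of volumes (`GradedLieGroup.map_dil`) rests on `exp` carrying additive Haar measure to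
Haar measure: `Y ↦ X ⋄ Y` is unipotent for the filtration by weights, hence a composition of
measure-preserving shears. -/

namespace GradedHardy

/-! ### Haar measure of a local field under multiplication -/

section LocalField

open scoped Pointwise

variable {K : Type*} [NontriviallyNormedField K] [IsUltrametricDist K]

theorem IsNormalizedAbs.one_lt_residueCard (hK : IsNormalizedAbs K) : 1 < residueCard K := by
  have h1 := hK.1.1
  obtain ⟨x, hx0, hx1⟩ := NormedField.exists_norm_lt_one K
  have h2 := hK.2 ⟨hx1, x, rfl⟩
  have h3 : (0 : ℝ) < (residueCard K : ℝ)⁻¹ := hx0.trans_le h2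
  have h4 := (inv_lt_one₀ (inv_pos.1 h3)).1 h1
  exact_mod_cast h4

theorem IsNormalizedAbs.exists_uniformizer (hK : IsNormalizedAbs K) :
    ∃ ϖ : Kˣ, ‖(ϖ : K)‖ = (residueCard K : ℝ)⁻¹ := by
  obtain ⟨x, hx⟩ := hK.1.2
  have := hK.one_lt_residueCard
  refine ⟨Units.mk0 x ?_, hx⟩
  rintro rfl
  simp only [norm_zero] at hx
  have : (0 : ℝ) < (residueCard K : ℝ)⁻¹ := by positivity
  linarith

theorem IsNormalizedAbs.norm_le_inv_of_lt_one (hK : IsNormalizedAbs K) {x : K} (hx : ‖x‖ < 1) :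
    ‖x‖ ≤ (residueCard K : ℝ)⁻¹ := hK.2 ⟨hx, x, rfl⟩

variable [MeasurableSpace K] [BorelSpace K]

/-- No norm lies strictly between `q⁻¹` and `1`, so the ball of radius `q⁻¹` is the maximal ideal of
the ring of integers, and the unit ball is the disjoint union of its `q` cosets. -/
theorem IsNormalizedAbs.measure_closedBall_one (hK : IsNormalizedAbs K) (m : Measure K)
    [m.IsAddLeftInvariant] :
    m (Metric.closedBall 0 1) =
      residueCard K * m (Metric.closedBall 0 (residueCard K : ℝ)⁻¹) := by
  set O := (NormedField.valuation (K := K)).valuationSubring with hO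
  have hmem : ∀ x : K, x ∈ O ↔ ‖x‖ ≤ 1 := fun x => by
    rw [hO, Valuation.mem_valuationSubring_iff, NormedField.valuation_apply, ← NNReal.coe_le_coe]
    simp
  have hmax : ∀ x : O, x ∈ IsLocalRing.maximalIdeal O ↔ ‖(x : K)‖ ≤ (residueCard K : ℝ)⁻¹ := by
    intro x
    rw [IsLocalRing.mem_maximalIdeal, mem_nonunits_iff, isUnit_iff_exists_inv]
    constructor
    · intro h
      refine hK.norm_le_inv_of_lt_one (lt_of_le_of_ne ((hmem _).1 x.2) fun h1 => h ?_)
      have hx0 : (x : K) ≠ 0 := by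
        intro h0; rw [h0] at h1; simp at h1
      refine ⟨⟨(x : K)⁻¹, (hmem _).2 (by rw [norm_inv, h1]; simp)⟩, ?_⟩
      exact Subtype.ext (mul_inv_cancel₀ hx0)
    · rintro h ⟨y, hy⟩
      have h2 : (x : K) * y = 1 := congrArg Subtype.val hy
      have h3 : ‖(x : K)‖ * ‖(y : K)‖ = 1 := by rw [← norm_mul, h2, norm_one]
      have h4 := (hmem _).1 y.2
      have h5 := hK.1.1
      nlinarith [norm_nonneg (x : K), norm_nonneg (y : K)]
  -- `Nat.card` of an infinite type is `0`, so `1 < residueCard K` forces finiteness.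
  have hfin : Finite (IsLocalRing.ResidueField O) :=
    Nat.finite_of_card_ne_zero (by exact (zero_lt_one.trans hK.one_lt_residueCard).ne')
  have hsurj := IsLocalRing.residue_surjective (R := O)
  choose σ hσ using hsurj
  have hun : Metric.closedBall (0 : K) 1 = ⋃ t : IsLocalRing.ResidueField O,
      (fun y => -(σ t : K) + y) ⁻¹' Metric.closedBall (0 : K) (residueCard K : ℝ)⁻¹ := by
    ext x
    simp only [mem_closedBall_zero_iff, Set.mem_iUnion, Set.mem_preimage]
    constructor
    · intro hx
      refine ⟨IsLocalRing.residue O ⟨x, (hmem x).2 hx⟩, ?_⟩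
      have : -σ (IsLocalRing.residue O ⟨x, (hmem x).2 hx⟩) + ⟨x, (hmem x).2 hx⟩ ∈
          IsLocalRing.maximalIdeal O := by
        rw [← IsLocalRing.residue_eq_zero_iff, map_add, map_neg, hσ]
        simp
      exact (hmax _).1 this
    · rintro ⟨t, ht⟩
      have h1 : x = σ t + (-(σ t : K) + x) := by ring
      rw [h1]
      exact (IsUltrametricDist.norm_add_le_max _ _).trans
        (max_le ((hmem _).1 (σ t).2) (ht.trans hK.1.1.le))
  rw [hun, measure_iUnion]
  · simp_rw [measure_preimage_add]
    rw [ENNReal.tsum_const, ENat.card_eq_coe_natCard]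
    rfl
  · intro t t' htt
    rw [Function.onFun, Set.disjoint_left]
    intro x hx hx'
    simp only [mem_closedBall_zero_iff, Set.mem_preimage] at hx hx'
    apply htt
    have h1 : σ t - σ t' ∈ IsLocalRing.maximalIdeal O := by
      rw [hmax]
      have : ((σ t - σ t' : O) : K) = (-(σ t' : K) + x) + -(-(σ t : K) + x) := by
        push_cast; ring
      rw [this]
      exact (IsUltrametricDist.norm_add_le_max _ _).trans (max_le hx' (by rwa [norm_neg]))
    rw [← IsLocalRing.residue_eq_zero_iff, map_sub, hσ, hσ, sub_eq_zero] at h1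
    exact h1
  · intro t
    exact (measurable_const_add _) Metric.isClosed_closedBall.measurableSet

variable [LocallyCompactSpace K]

theorem IsNormalizedAbs.distribHaarChar_uniformizer (hK : IsNormalizedAbs K) {ϖ : Kˣ}
    (hϖ : ‖(ϖ : K)‖ = (residueCard K : ℝ)⁻¹) :
    distribHaarChar K ϖ = (residueCard K : ℝ≥0)⁻¹ := by
  have : ProperSpace K := ProperSpace.of_locallyCompactSpace K
  have hq := hK.one_lt_residueCard
  set m : Measure K := Measure.addHaar
  have hfin : m (Metric.closedBall 0 1) ≠ ⊤ := (isCompact_closedBall 0 1).measure_ne_top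
  have hpos : m (Metric.closedBall 0 1) ≠ 0 :=
    (Metric.measure_closedBall_pos m 0 one_pos).ne'
  refine distribHaarChar_eq_of_measure_smul_eq_mul (μ := m) hpos hfin ?_
  have : ϖ • Metric.closedBall (0 : K) 1 = Metric.closedBall 0 (residueCard K : ℝ)⁻¹ := by
    rw [← hϖ]
    have := smul_closedBall (ϖ : K) (0 : K) (r := 1) zero_le_one
    rw [smul_zero, mul_one] at this
    exact this
  rw [this, hK.measure_closedBall_one m, ← mul_assoc]
  rw [ENNReal.coe_inv (by positivity), ENNReal.coe_natCast, ENNReal.inv_mul_cancel, one_mul]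
  · simp; omega
  · simp

/-- Multiplication by a scalar on a local field scales the Haar measure. -/
theorem IsNormalizedAbs.map_mul_zpow (hK : IsNormalizedAbs K) {ϖ : Kˣ}
    (hϖ : ‖(ϖ : K)‖ = (residueCard K : ℝ)⁻¹) (m : Measure K) [m.IsAddHaarMeasure] (n : ℤ) :
    m.map (fun x => (ϖ : K) ^ n * x) = (residueCard K : ℝ≥0) ^ n • m := by
  have : ProperSpace K := ProperSpace.of_locallyCompactSpace K
  ext s hs
  rw [Measure.map_apply (measurable_const_mul _) hs, Measure.smul_apply, ENNReal.smul_def, smul_eq_mul]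
  -- A pushforward measures preimages, that is, dilates by `ϖ^{-n}`; hence the factor `q^n` and not
  -- `q^{-n}`.
  have h1 : (fun x => (ϖ : K) ^ n * x) ⁻¹' s = (ϖ ^ (-n)) • s := by
    rw [zpow_neg, ← Set.preimage_smul]
    ext x
    simp [Units.smul_def]
  rw [h1, ← distribHaarChar_mul, map_zpow, hK.distribHaarChar_uniformizer hϖ]
  rw [inv_zpow', neg_neg]

end LocalField

/-! ### Triangularity of the Baker-Campbell-Hausdorff product -/

section Words

variable {L : Type*}

theorem length_bchWord (X Y : L) {n : ℕ} (e : Fin n → ℕ × ℕ) :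
    (bchWord X Y e).length = ∑ i, ((e i).1 + (e i).2) := by
  rw [bchWord, List.length_flatMap, List.map_ofFn, List.sum_ofFn]
  simp

/-- Serves to compare `X ⋄ (Y + W)` with `X ⋄ Y` letter by letter, `R` being congruence modulo a
tail. -/
theorem forall₂_bchWord {R : L → L → Prop} {X Y Y' : L} (hX : R X X) (hY : R Y' Y) {n : ℕ}
    (e : Fin n → ℕ × ℕ) : List.Forall₂ R (bchWord X Y' e) (bchWord X Y e) := by
  have hrep : ∀ (m : ℕ) (a a' : L), R a a' →
      List.Forall₂ R (List.replicate m a) (List.replicate m a') := by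
    intro m a a' h
    induction m with
    | zero => exact List.Forall₂.nil
    | succ m ih => exact List.Forall₂.cons h ih
  unfold bchWord
  generalize List.ofFn e = l
  induction l with
  | nil => exact List.Forall₂.nil
  | cons p l ih =>
    exact List.rel_append (List.rel_append (hrep _ _ _ hX) (hrep _ _ _ hY)) ih

end Words

section Lie

variable {K L ι : Type*} [Field K] [LieRing L] [LieAlgebra K L] {S : LieGradation K L}
  (b : AdaptedBasis S ι)

/-- The span of the homogeneous components of degree at least `k`. -/
def AdaptedBasis.tail (k : ℕ) : Submodule K L where
  carrier := {X | ∀ i, b.weight i < k → b.basis.repr X i = 0}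
  add_mem' := fun {X Y} hX hY i hi => by simp [hX i hi, hY i hi]
  zero_mem' := fun i _ => by simp
  smul_mem' := fun c X hX i hi => by simp [hX i hi]

theorem AdaptedBasis.mem_tail {k : ℕ} {X : L} :
    X ∈ b.tail k ↔ ∀ i, b.weight i < k → b.basis.repr X i = 0 := Iff.rfl

theorem AdaptedBasis.tail_anti {j k : ℕ} (h : j ≤ k) : b.tail k ≤ b.tail j :=
  fun _ hX i hi => hX i (hi.trans_le h)

theorem AdaptedBasis.weight_ne_zero (i : ι) : b.weight i ≠ 0 := by
  intro h
  have := b.mem i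
  rw [h, S.V_zero, Submodule.mem_bot] at this
  exact b.basis.ne_zero i this

theorem AdaptedBasis.mem_tail_one (X : L) : X ∈ b.tail 1 := fun i hi =>
  absurd (Nat.lt_one_iff.1 hi) (b.weight_ne_zero i)

theorem AdaptedBasis.dilation_basis (γ : K) (i : ι) :
    S.dilation γ (b.basis i) = γ ^ b.weight i • b.basis i :=
  S.dilation_of_mem γ (b.mem i)

theorem AdaptedBasis.repr_dilation (γ : K) (X : L) (i : ι) :
    b.basis.repr (S.dilation γ X) i = γ ^ b.weight i * b.basis.repr X i := by
  have h : (Finsupp.lapply i ∘ₗ b.basis.repr.toLinearMap) ∘ₗ S.dilation γ =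
      γ ^ b.weight i • (Finsupp.lapply i ∘ₗ b.basis.repr.toLinearMap) := by
    refine b.basis.ext fun j => ?_
    simp only [LinearMap.comp_apply, b.dilation_basis, LinearEquiv.coe_coe, map_smul,
      LinearMap.smul_apply, Module.Basis.repr_self, Finsupp.lapply_apply, smul_eq_mul]
    by_cases hij : j = i
    · rw [hij]
    · rw [Finsupp.single_eq_of_ne (Ne.symm hij), mul_zero, mul_zero]
  exact LinearMap.congr_fun h X

end Lie

section Graded

variable {K L ι : Type*} [NontriviallyNormedField K] [LieRing L] [LieAlgebra K L]
  {S : LieGradation K L} (b : AdaptedBasis S ι)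

/-- For `0 < ‖γ‖ < 1` the dilation `D_γ` multiplies the `i`-th coordinate of `X` both by `γ ^ k` and
by `γ ^ b.weight i`, and distinct powers of `γ` differ. -/
theorem AdaptedBasis.repr_eq_zero {k : ℕ} {X : L} (hX : X ∈ S.V k) {i : ι}
    (hi : b.weight i ≠ k) : b.basis.repr X i = 0 := by
  obtain ⟨γ, h0, h1⟩ := NormedField.exists_norm_lt_one K
  have h2 := b.repr_dilation γ X i
  rw [S.dilation_of_mem γ hX, map_smul, Finsupp.smul_apply, smul_eq_mul] at h2
  by_contra h3
  have h4 := mul_right_cancel₀ h3 h2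
  have h5 := congrArg norm h4
  rw [norm_pow, norm_pow] at h5
  exact hi ((pow_right_injective₀ h0 h1.ne) h5.symm)

theorem AdaptedBasis.mem_tail_of_mem {k j : ℕ} (hj : j ≤ k) {X : L} (hX : X ∈ S.V k) :
    X ∈ b.tail j := fun _ hi => b.repr_eq_zero hX (hi.trans_le hj).ne

theorem AdaptedBasis.mem_span_of_mem {k : ℕ} {X : L} (hX : X ∈ S.V k) :
    X ∈ Submodule.span K (b.basis '' {i | b.weight i = k}) := by
  rw [b.basis.mem_span_image]
  intro i hi
  by_contra h
  exact (Finsupp.mem_support_iff.1 hi) (b.repr_eq_zero hX h)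

variable [Fintype ι]

theorem AdaptedBasis.finrank_V (k : ℕ) :
    Module.finrank K (S.V k) = (Finset.univ.filter fun i => b.weight i = k).card := by
  have h : S.V k = Submodule.span K
      (Set.range fun i : {i // b.weight i = k} => b.basis i) := by
    refine le_antisymm (fun X hX => ?_) (Submodule.span_le.2 ?_)
    · convert b.mem_span_of_mem hX using 2
      ext y
      simp
    · rintro _ ⟨⟨i, rfl⟩, rfl⟩
      exact b.mem i
  rw [h, ← Fintype.card_subtype]
  exact finrank_span_eq_card (b.basis.linearIndependent.comp _ Subtype.val_injective)

/-- Identifies `Q` with the exponent that dilations produce in adapted coordinates. -/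
theorem AdaptedBasis.homDim_eq : S.homDim = ∑ i, b.weight i := by
  rw [LieGradation.homDim, finsum_eq_sum_of_support_subset (s := Finset.univ.image b.weight)]
  · rw [← Finset.sum_fiberwise_of_maps_to (fun i hi => Finset.mem_image_of_mem b.weight hi)]
    refine Finset.sum_congr rfl fun k _ => ?_
    rw [b.finrank_V, Finset.sum_congr rfl fun i hi => (Finset.mem_filter.1 hi).2]
    simp [mul_comm]
  · intro k hk
    rw [Function.mem_support, b.finrank_V] at hk
    have : (Finset.univ.filter fun i => b.weight i = k).Nonempty := by
      rw [← Finset.card_pos]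
      exact Nat.pos_of_ne_zero (right_ne_zero_of_mul hk)
    obtain ⟨i, hi⟩ := this
    simp only [Finset.coe_image, Set.mem_image]
    exact ⟨i, by simp, (Finset.mem_filter.1 hi).2⟩

theorem AdaptedBasis.lie_mem_tail {j k : ℕ} {X Y : L} (hX : X ∈ b.tail j) (hY : Y ∈ b.tail k) :
    ⁅X, Y⁆ ∈ b.tail (j + k) := by
  rw [← b.basis.sum_repr X, ← b.basis.sum_repr Y]
  rw [sum_lie_sum]
  refine Submodule.sum_mem _ fun i _ => Submodule.sum_mem _ fun i' _ => ?_
  rw [smul_lie, lie_smul]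
  by_cases h1 : b.weight i < j
  · rw [hX i h1, zero_smul]; exact zero_mem _
  by_cases h2 : b.weight i' < k
  · rw [hY i' h2, zero_smul, smul_zero]; exact zero_mem _
  · exact Submodule.smul_mem _ _ (Submodule.smul_mem _ _
      (b.mem_tail_of_mem (by omega) (S.lie_mem _ _ _ (b.mem i) _ (b.mem i'))))

/-- Telescoping: `⁅a, u⁆ - ⁅a', u'⁆ = ⁅a - a', u⁆ + ⁅a', u - u'⁆`. All weights are at least `1`, so
one bracket already raises the degree of the difference. -/
theorem AdaptedBasis.nestedBracket_sub_mem {k : ℕ} {l l' : List L}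
    (h : List.Forall₂ (fun a a' => a - a' ∈ b.tail k) l l') :
    nestedBracket l - nestedBracket l' ∈ b.tail k ∧
      (2 ≤ l.length → nestedBracket l - nestedBracket l' ∈ b.tail (k + 1)) := by
  induction h with
  | nil => simp [nestedBracket]
  | @cons a a' l l' ha hl ih =>
    cases hl with
    | nil => exact ⟨by simpa [nestedBracket] using ha, by simp⟩
    | @cons c c' l l' hc hl =>
      have key : ⁅a, nestedBracket (c :: l)⁆ - ⁅a', nestedBracket (c' :: l')⁆ ∈
          b.tail (k + 1) := by
        have : ⁅a, nestedBracket (c :: l)⁆ - ⁅a', nestedBracket (c' :: l')⁆ =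
            ⁅a - a', nestedBracket (c :: l)⁆ +
              ⁅a', nestedBracket (c :: l) - nestedBracket (c' :: l')⁆ := by
          rw [sub_lie, lie_sub]; abel
        rw [this]
        refine add_mem (b.lie_mem_tail ha (b.mem_tail_one _)) ?_
        rw [add_comm]
        exact b.lie_mem_tail (b.mem_tail_one _) ih.1
      exact ⟨b.tail_anti (Nat.le_succ k) key, fun _ => key⟩

/-- A word with two or more letters gains a degree from a bracket. Of the one-letter words, `X` does
not involve `W`, and `he1` excludes the other. -/
theorem AdaptedBasis.nestedBracket_bchWord_sub_mem {k : ℕ} {X Y W : L} (hW : W ∈ b.tail k)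
    {n : ℕ} (hn : n ≠ 0) {e : Fin n → ℕ × ℕ} (he : ∀ i, e i ≠ (0, 0))
    (he1 : n = 1 → e ≠ fun _ => (0, 1)) :
    nestedBracket (bchWord X (Y + W) e) - nestedBracket (bchWord X Y e) ∈ b.tail (k + 1) := by
  by_cases h2 : 2 ≤ (bchWord X (Y + W) e).length
  · exact (b.nestedBracket_sub_mem (forall₂_bchWord (by simp) (by simpa using hW) e)).2 h2
  have hpos : ∀ i, 1 ≤ (e i).1 + (e i).2 := fun i => by
    by_contra h
    exact he i (Prod.ext (by simp; omega) (by simp; omega))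
  rw [length_bchWord] at h2
  have hle : n ≤ ∑ i, ((e i).1 + (e i).2) := by
    calc n = ∑ _i : Fin n, 1 := by simp
      _ ≤ _ := Finset.sum_le_sum fun i _ => hpos i
  obtain rfl : n = 1 := by omega
  rw [Fin.sum_univ_one] at h2
  have h3 := hpos 0
  have h4 : e 0 = (1, 0) := by
    by_contra h
    refine he1 rfl (funext fun i => ?_)
    rw [Subsingleton.elim i 0]
    have h5 : (e 0).1 ≠ 1 := fun h6 => h (Prod.ext h6 (by simp; omega))
    exact Prod.ext (by simp; omega) (by simp; omega)
  simp [bchWord, h4]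

/-- In each degree, the BCH product `X ⋄ Y` is `Y` plus a term that only depends on the
components of `Y` of smaller degree. -/
theorem AdaptedBasis.bch_add_sub_mem (hc : LieModule.nilpotencyLength L L ≠ 0) {k : ℕ}
    {X Y W : L} (hW : W ∈ b.tail k) :
    bch K X (Y + W) - bch K X Y - W ∈ b.tail (k + 1) := by
  unfold bch
  have h1 : 1 ∈ Finset.Icc 1 (LieModule.nilpotencyLength L L) := by
    rw [Finset.mem_Icc]; omega
  -- The single-letter word of the second argument, `n = 1` and `e = (0, 1)`, has coefficient `1`
  -- and contributes exactly `W`; all other terms gain a degree.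
  rw [← Finset.add_sum_erase _ _ h1, ← Finset.add_sum_erase (Finset.Icc 1 _) _ h1]
  have h2 : (fun _ => (0, 1) : Fin 1 → ℕ × ℕ) ∈ Fintype.piFinset (fun _ : Fin 1 =>
        (Finset.range (LieModule.nilpotencyLength L L + 1) ×ˢ
          Finset.range (LieModule.nilpotencyLength L L + 1)).erase (0, 0)) := by
    rw [Fintype.mem_piFinset]
    intro _
    simp only [Finset.mem_erase, Finset.mem_product, Finset.mem_range]
    refine ⟨by simp, by omega, by omega⟩
  rw [← Finset.add_sum_erase _ _ h2, ← Finset.add_sum_erase (Fintype.piFinset _) _ h2]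
  have h3 : ∀ Z : L, nestedBracket (bchWord X Z (fun _ => (0, 1) : Fin 1 → ℕ × ℕ)) = Z := by
    intro Z; simp [bchWord, nestedBracket]
  rw [h3, h3]
  have h4 : ∀ a a' p p' t t' : L, a - a' = W → p - p' ∈ b.tail (k + 1) →
      t - t' ∈ b.tail (k + 1) → a + p + t - (a' + p' + t') - W ∈ b.tail (k + 1) := by
    intro a a' p p' t t' ha hp ht
    have : a + p + t - (a' + p' + t') - W = (p - p') + (t - t') := by rw [← ha]; abel
    rw [this]
    exact add_mem hp ht
  refine h4 _ _ _ _ _ _ ?_ ?_ ?_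
  · rw [← smul_sub]; simp
  · rw [← Finset.sum_sub_distrib]
    refine Submodule.sum_mem _ fun e he => ?_
    rw [← smul_sub]
    rw [Finset.mem_erase, Fintype.mem_piFinset] at he
    exact Submodule.smul_mem _ _ (b.nestedBracket_bchWord_sub_mem hW one_ne_zero
      (fun i => (Finset.mem_erase.1 (he.2 i)).1) fun _ => he.1)
  · rw [← Finset.sum_sub_distrib]
    refine Submodule.sum_mem _ fun n hn => ?_
    rw [← Finset.sum_sub_distrib]
    refine Submodule.sum_mem _ fun e he => ?_
    rw [← smul_sub]
    rw [Finset.mem_erase, Finset.mem_Icc] at hn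
    rw [Fintype.mem_piFinset] at he
    exact Submodule.smul_mem _ _ (b.nestedBracket_bchWord_sub_mem hW (by omega)
      (fun i => (Finset.mem_erase.1 (he i)).1) fun h => absurd h hn.1)

/-- The linear projection keeping the coordinates whose weight satisfies `p`. -/
noncomputable def AdaptedBasis.proj (p : ℕ → Prop) [DecidablePred p] : L →ₗ[K] L :=
  b.basis.constr K fun i => if p (b.weight i) then b.basis i else 0

theorem AdaptedBasis.repr_proj (p : ℕ → Prop) [DecidablePred p] (X : L) (i : ι) :
    b.basis.repr (b.proj p X) i = if p (b.weight i) then b.basis.repr X i else 0 := by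
  rw [AdaptedBasis.proj, Module.Basis.constr_apply_fintype, map_sum, Finsupp.finsetSum_apply,
    Finset.sum_eq_single i]
  · split_ifs <;> simp
  · intro j _ hj
    split_ifs <;> simp [Finsupp.single_eq_of_ne (Ne.symm hj)]
  · simp

end Graded

/-! ### Unipotent maps preserve Haar measure -/

/-- A shear `y ↦ y + g y`, with `g` taking values in the range of a projection `P` and invariant
under translations by this range, preserves invariant measures. -/
theorem measurePreserving_add_of_invariant {A : Type*} [AddCommGroup A] [MeasurableSpace A]
    [MeasurableAdd₂ A] [MeasurableNeg A] {m : Measure A} [SFinite m] [m.IsAddLeftInvariant]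
    {s : Set A} (hs : MeasurableSet s) (hs0 : m s ≠ 0) (hs1 : m s ≠ ⊤)
    {P : A →+ A} (hP : Measurable P) {g : A → A} (hg : Measurable g)
    (hgP : ∀ y w, g (y + P w) = g y) (hPg : ∀ y, P (g y) = g y) :
    MeasurePreserving (fun y => y + g y) m m := by
  have hmeas : Measurable fun y => y + g y := measurable_id.add hg
  refine ⟨hmeas, Measure.ext fun t ht => ?_⟩
  set h : A → ℝ≥0∞ := s.indicator 1 with hh
  set f : A → ℝ≥0∞ := t.indicator 1 with hf
  have hhm : Measurable h := measurable_one.indicator hs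
  have hfm : Measurable f := measurable_one.indicator ht
  have hint : ∫⁻ w, h w ∂m = m s := lintegral_indicator_one hs
  -- Averaging over the translates `y + P w`, weighted by `h w`, avoids disintegrating `m` along the
  -- range of `P`. Since `P (g y) = g y`, the shear becomes the shift `w ↦ w + g y`, which Tonelli
  -- and a translation in `w` move onto `h`; integrating `h` then removes it.
  have key : (∫⁻ w, h w ∂m) * ∫⁻ y, f (y + g y) ∂m = (∫⁻ w, h w ∂m) * ∫⁻ y, f y ∂m := by
    calc (∫⁻ w, h w ∂m) * ∫⁻ y, f (y + g y) ∂m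
        = ∫⁻ w, h w * ∫⁻ y, f (y + g y) ∂m ∂m := (lintegral_mul_const _ hhm).symm
      _ = ∫⁻ w, ∫⁻ y, h w * f (y + P (w + g y)) ∂m ∂m := by
          refine lintegral_congr fun w => ?_
          rw [← lintegral_add_right_eq_self (fun y => f (y + g y)) (P w),
            ← lintegral_const_mul _ (by fun_prop)]
          refine lintegral_congr fun y => ?_
          rw [hgP, map_add, hPg, add_assoc]
      _ = ∫⁻ y, ∫⁻ w, h w * f (y + P (w + g y)) ∂m ∂m :=
          lintegral_lintegral_swap (by fun_prop)
      _ = ∫⁻ y, ∫⁻ w, h (w - g y) * f (y + P w) ∂m ∂m := by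
          refine lintegral_congr fun y => ?_
          rw [← lintegral_add_right_eq_self (fun w => h (w - g y) * f (y + P w)) (g y)]
          simp only [add_sub_cancel_right]
      _ = ∫⁻ w, ∫⁻ y, h (w - g y) * f (y + P w) ∂m ∂m :=
          lintegral_lintegral_swap (by fun_prop)
      _ = ∫⁻ w, ∫⁻ y, h (w - g y) * f y ∂m ∂m := by
          refine lintegral_congr fun w => ?_
          rw [← lintegral_add_right_eq_self (fun y => h (w - g y) * f y) (P w)]
          simp only [hgP]
      _ = ∫⁻ y, ∫⁻ w, h (w - g y) * f y ∂m ∂m :=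
          lintegral_lintegral_swap (by fun_prop)
      _ = ∫⁻ y, (∫⁻ w, h w ∂m) * f y ∂m := by
          refine lintegral_congr fun y => ?_
          rw [lintegral_mul_const _ (by fun_prop), lintegral_sub_right_eq_self h (g y)]
      _ = _ := lintegral_const_mul _ hfm
  rw [hint, ENNReal.mul_right_inj hs0 hs1] at key
  rw [Measure.map_apply hmeas ht, ← lintegral_indicator_one ht,
    ← lintegral_indicator_one (hmeas ht)]
  exact key

section Shear

variable {K L ι : Type*} [NontriviallyNormedField K] [CompleteSpace K] [LieRing L]
  [LieAlgebra K L] [TopologicalSpace L] [T2Space L] [IsTopologicalAddGroup L]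
  [ContinuousSMul K L] [MeasurableSpace L] [BorelSpace L] [SecondCountableTopology L]
  [LocallyCompactSpace L] {S : LieGradation K L} [Fintype ι] (b : AdaptedBasis S ι)

/-- By `h`, the component of `T Y - Y` of weight `k` depends only on the components of `Y` of weight
less than `k`. Thus `T` is a composition of shears, one for each weight. -/
theorem AdaptedBasis.measurePreserving_of_sub_mem_tail (m : Measure L) [m.IsAddHaarMeasure]
    {T : L → L} (hT : Continuous T)
    (h : ∀ k, ∀ Y, ∀ W ∈ b.tail k, T (Y + W) - T Y - W ∈ b.tail (k + 1)) :
    MeasurePreserving T m m := by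
  have : FiniteDimensional K L := b.basis.finiteDimensional_of_finite
  obtain ⟨s⟩ : Nonempty (TopologicalSpace.PositiveCompacts L) := inferInstance
  have hs0 : m s ≠ 0 := (Measure.measure_pos_of_nonempty_interior m s.interior_nonempty).ne'
  have hs1 : m s ≠ ⊤ := s.isCompact.measure_ne_top
  have hQc : ∀ (p : ℕ → Prop) [DecidablePred p], Continuous (b.proj p) := fun p _ =>
    (b.proj p).continuous_of_finiteDimensional
  have hd : ∀ k Y W, W ∈ b.tail k →
      (T (Y + W) - (Y + W)) - (T Y - Y) ∈ b.tail (k + 1) := by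
    intro k Y W hW
    have := h k Y W hW
    convert this using 1
    abel
  -- Truncations of `T`: the one at `N + 1` is the one at `N` after the shear in weight `N`, because
  -- changing `Y` in weight `N` does not affect the increments of smaller weight.
  have htr : ∀ N : ℕ, MeasurePreserving (fun Y => Y + b.proj (· < N) (T Y - Y)) m m := by
    intro N
    induction N with
    | zero =>
      convert MeasurePreserving.id m using 2 with Y
      rw [show b.proj (· < 0) (T Y - Y) = 0 from b.basis.ext_elem fun i => by
        rw [b.repr_proj]; simp]
      simp
    | succ N ih =>
      have hP : ∀ Z, b.proj (· = N) Z ∈ b.tail N := fun Z i hi => by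
        rw [b.repr_proj, if_neg hi.ne]
      have hg : Continuous fun Y => b.proj (· = N) (T Y - Y) :=
        (hQc _).comp (hT.sub continuous_id)
      have hgP : ∀ Y W, b.proj (· = N) (T (Y + b.proj (· = N) W) - (Y + b.proj (· = N) W)) =
          b.proj (· = N) (T Y - Y) := fun Y W => by
        refine b.basis.ext_elem fun i => ?_
        rw [b.repr_proj, b.repr_proj]
        by_cases hi : b.weight i = N
        · have := b.mem_tail.1 (hd N Y _ (hP W)) i (by omega)
          rw [map_sub, Finsupp.sub_apply, sub_eq_zero] at this
          rw [if_pos hi, if_pos hi, this]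
        · rw [if_neg hi, if_neg hi]
      have hPP : ∀ Z, b.proj (· = N) (b.proj (· = N) Z) = b.proj (· = N) Z := fun Z => by
        refine b.basis.ext_elem fun i => ?_
        rw [b.repr_proj, b.repr_proj]
        by_cases hi : b.weight i = N
        · rw [if_pos hi]
        · rw [if_neg hi, if_neg hi]
      have hPm : Measurable (b.proj (· = N)).toAddMonoidHom := (hQc (· = N)).measurable
      have hgm := hg.measurable
      have hS : MeasurePreserving (fun Y => Y + b.proj (· = N) (T Y - Y)) m m :=
        measurePreserving_add_of_invariant s.isCompact.isClosed.measurableSet hs0 hs1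
          (P := (b.proj (· = N)).toAddMonoidHom) hPm hgm hgP fun Y => hPP (T Y - Y)
      have hcomp : (fun Y => Y + b.proj (· < N + 1) (T Y - Y)) =
          (fun Y => Y + b.proj (· < N) (T Y - Y)) ∘
            fun Y => Y + b.proj (· = N) (T Y - Y) := by
        funext Y
        have h3 := hd N Y _ (hP (T Y - Y))
        rw [Function.comp_apply]
        generalize T (Y + _) - _ = Z at h3 ⊢
        generalize T Y - Y = Z' at h3 ⊢
        refine b.basis.ext_elem fun i => ?_
        rw [map_add, map_add, map_add, Finsupp.add_apply, Finsupp.add_apply, Finsupp.add_apply,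
          b.repr_proj, b.repr_proj, b.repr_proj, add_assoc]
        congr 1
        by_cases h1 : b.weight i < N
        · have h4 := b.mem_tail.1 h3 i (by omega)
          rw [map_sub, Finsupp.sub_apply, sub_eq_zero] at h4
          rw [if_pos (by omega), if_neg (by omega), if_pos h1, h4, zero_add]
        · by_cases h2 : b.weight i = N
          · rw [if_pos (by omega), if_pos h2, if_neg h1, add_zero]
          · rw [if_neg (by omega), if_neg h2, if_neg h1, add_zero]
      rw [hcomp]
      exact ih.comp hS
  -- This bound exceeds every weight, so nothing is truncated.
  convert htr ((∑ i, b.weight i) + 1) using 2 with Y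
  refine b.basis.ext_elem fun i => ?_
  have : b.weight i < (∑ i, b.weight i) + 1 :=
    Nat.lt_succ_of_le (Finset.single_le_sum (f := b.weight) (fun _ _ => Nat.zero_le _)
      (Finset.mem_univ i))
  rw [map_add, Finsupp.add_apply, b.repr_proj, if_pos this, map_sub, Finsupp.sub_apply]
  abel

end Shear

/-! ### Haar measure of the group and its scaling under dilations -/

theorem IsNormalizedAbs.map_pi_mul_zpow {K ι : Type*} [NontriviallyNormedField K]
    [IsUltrametricDist K] [LocallyCompactSpace K] [SecondCountableTopology K] [MeasurableSpace K]
    [BorelSpace K] [Fintype ι] (hK : IsNormalizedAbs K) {ϖ : Kˣ}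
    (hϖ : ‖(ϖ : K)‖ = (residueCard K : ℝ)⁻¹) (m : Measure K) [m.IsAddHaarMeasure]
    (n : ℤ) (w : ι → ℕ) :
    (Measure.pi fun _ : ι => m).map (fun x i => ((ϖ : K) ^ n) ^ w i * x i) =
      (residueCard K : ℝ≥0) ^ (n * (∑ i, w i : ℕ)) • Measure.pi fun _ : ι => m := by
  have hq : (residueCard K : ℝ≥0) ≠ 0 := by
    exact_mod_cast (zero_lt_one.trans hK.one_lt_residueCard).ne'
  set c : ℝ≥0 := (residueCard K : ℝ≥0) ^ (n * (∑ i, w i : ℕ)) with hc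
  have hc0 : c ≠ 0 := zpow_ne_zero _ hq
  have hcp : c = ∏ i, (residueCard K : ℝ≥0) ^ (n * (w i : ℤ)) := by
    simp_rw [hc, zpow_mul, zpow_natCast]
    rw [Finset.prod_pow_eq_pow_sum]
  have hcoord : ∀ i, m.map (fun x => ((ϖ : K) ^ n) ^ w i * x) =
      (residueCard K : ℝ≥0) ^ (n * (w i : ℤ)) • m := fun i => by
    rw [← hK.map_mul_zpow hϖ m (n * (w i : ℤ)), zpow_mul, zpow_natCast]
  have hmeas : Measurable fun (x : ι → K) i => ((ϖ : K) ^ n) ^ w i * x i := by fun_prop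
  -- With the factor moved to this side, `Measure.pi_eq` reduces the identity to boxes, where each
  -- coordinate contributes `q^{n w_i}`.
  have key : (Measure.pi fun _ : ι => m) = c⁻¹ •
      (Measure.pi fun _ : ι => m).map (fun x i => ((ϖ : K) ^ n) ^ w i * x i) := by
    refine Measure.pi_eq fun s hs => ?_
    rw [Measure.smul_apply, ENNReal.smul_def, smul_eq_mul, Measure.map_apply hmeas (.univ_pi hs)]
    have : (fun (x : ι → K) i => ((ϖ : K) ^ n) ^ w i * x i) ⁻¹' (Set.univ.pi s) =
      Set.univ.pi (fun i => (fun x => ((ϖ : K) ^ n) ^ w i * x) ⁻¹' (s i)) := by ext x; simp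
    rw [this, Measure.pi_pi]
    have h2 : ∀ i, m ((fun x => ((ϖ : K) ^ n) ^ w i * x) ⁻¹' (s i)) =
        ((residueCard K : ℝ≥0) ^ (n * (w i : ℤ)) : ℝ≥0) * m (s i) := fun i => by
      rw [← Measure.map_apply (measurable_const_mul _) (hs i), hcoord,
        Measure.smul_apply, ENNReal.smul_def, smul_eq_mul]
    simp_rw [h2]
    rw [Finset.prod_mul_distrib, ← ENNReal.ofNNReal_finsetProd, ← hcp, ← mul_assoc,
      ← ENNReal.coe_mul, inv_mul_cancel₀ hc0, ENNReal.coe_one, one_mul]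
  conv_rhs => rw [key]
  rw [smul_smul, mul_inv_cancel₀ hc0, one_smul]

section

variable {K L G ι : Type*} [NontriviallyNormedField K] [LieRing L]
  [LieAlgebra K L] [TopologicalSpace L] [Group G] [TopologicalSpace G]
  (S : GradedLieGroup K L G)

/-- All brackets of zeros vanish, so `exp 0` is an idempotent of the group. -/
theorem GradedLieGroup.exp_zero : S.exp 0 = 1 := by
  have h0 : ∀ l : List L, (∀ a ∈ l, a = 0) → nestedBracket l = 0 := by
    intro l
    induction l with
    | nil => intro _; rfl
    | cons a l ih =>
      intro h
      cases l with
      | nil => exact h a (by simp)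
      | cons c l =>
        rw [nestedBracket, h a (by simp), zero_lie]
  have h1 : bch K (0 : L) 0 = 0 := by
    unfold bch
    refine Finset.sum_eq_zero fun n _ => Finset.sum_eq_zero fun e _ => ?_
    rw [h0, smul_zero]
    intro a ha
    simp only [bchWord, List.mem_flatMap, List.mem_append, List.mem_replicate] at ha
    obtain ⟨p, _, h | h⟩ := ha
    · exact h.2
    · exact h.2
  have h2 := S.exp_mul_exp 0 0
  rw [h1] at h2
  exact mul_eq_right.1 h2

/-- With length `0` the BCH sum is empty and the product of `G` would be constant. -/
theorem GradedLieGroup.nilpotencyLength_ne_zero {K L G : Type*} [NontriviallyNormedField K]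
    [LieRing L] [LieAlgebra K L] [TopologicalSpace L] [Group G] [TopologicalSpace G] [Nontrivial G]
    (S : GradedLieGroup K L G) :
    LieModule.nilpotencyLength L L ≠ 0 := by
  intro h
  have h1 : ∀ X Y : L, bch K X Y = 0 := fun X Y => by rw [bch, h]; rfl
  obtain ⟨x, hx⟩ := exists_ne (1 : G)
  have h2 := S.exp_mul_exp (S.exp.symm x) (S.exp.symm 1)
  rw [h1, S.exp_zero, Homeomorph.apply_symm_apply, Homeomorph.apply_symm_apply, mul_one] at h2
  exact hx h2

variable [IsTopologicalGroup G] [MeasurableSpace G] [BorelSpace G] [MeasurableSpace L]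
  [BorelSpace L] [CompleteSpace K] [T2Space L] [IsTopologicalAddGroup L]
  [ContinuousSMul K L] [SecondCountableTopology L] [LocallyCompactSpace L] [Fintype ι]

/-- The exponential map sends an additive Haar measure to a Haar measure. -/
theorem GradedLieGroup.isHaarMeasure_map_exp [Nontrivial G] (b : AdaptedBasis S.toLieGradation ι)
    (m : Measure L) [m.IsAddHaarMeasure] : (m.map S.exp).IsHaarMeasure where
  map_mul_left_eq_self g := by
    obtain ⟨X, rfl⟩ := S.exp.surjective g
    -- Continuity is transported from the multiplication of `G`, not read off the BCH formula.
    have hT : Continuous fun Y : L => bch K X Y := by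
      have : (fun Y : L => bch K X Y) = fun Y => S.exp.symm (S.exp X * S.exp Y) := by
        funext Y; rw [S.exp_mul_exp, Homeomorph.symm_apply_apply]
      rw [this]
      fun_prop
    have hmp := b.measurePreserving_of_sub_mem_tail m hT fun k Y W hW =>
      b.bch_add_sub_mem S.nilpotencyLength_ne_zero hW
    rw [Measure.map_map (measurable_const_mul _) S.exp.measurable]
    have : (fun x => S.exp X * x) ∘ S.exp = S.exp ∘ fun Y : L => bch K X Y := by
      funext Y; exact S.exp_mul_exp X Y
    rw [this, ← Measure.map_map S.exp.measurable hT.measurable, hmp.map_eq]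
  lt_top_of_isCompact k hk := by
    have := S.exp.toMeasurableEquiv.map_apply (μ := m) k
    rw [Homeomorph.toMeasurableEquiv_coe] at this
    rw [this]
    exact (S.exp.isCompact_preimage.2 hk).measure_lt_top
  toIsOpenPosMeasure := S.exp.continuous.isOpenPosMeasure_map S.exp.surjective

end

/-- The dilation by a power of a uniformizer multiplies the Haar measure by a power of the
cardinality of the residue field whose exponent is the homogeneous dimension. -/
theorem GradedLieGroup.map_dil {K L G ι : Type*} [NontriviallyNormedField K]
    [IsUltrametricDist K] [LocallyCompactSpace K] (hK : IsNormalizedAbs K)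
    [LieRing L] [LieAlgebra K L] [TopologicalSpace L] [T2Space L] [IsTopologicalAddGroup L]
    [ContinuousSMul K L] [Group G] [TopologicalSpace G] [IsTopologicalGroup G] [MeasurableSpace G]
    [BorelSpace G] [Nontrivial G] (S : GradedLieGroup K L G) [Fintype ι]
    (b : AdaptedBasis S.toLieGradation ι) (μ : Measure G) [μ.IsHaarMeasure] {ϖ : Kˣ}
    (hϖ : ‖(ϖ : K)‖ = (residueCard K : ℝ)⁻¹) (n : ℤ) :
    μ.map (S.dil ((ϖ : K) ^ n)) =
      (residueCard K : ℝ≥0) ^ (n * (S.toLieGradation.homDim : ℤ)) • μ := by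
  have : ProperSpace K := ProperSpace.of_locallyCompactSpace K
  have : FiniteDimensional K L := b.basis.finiteDimensional_of_finite
  borelize K L
  set e := b.basis.equivFunL
  have : LocallyCompactSpace L := e.toHomeomorph.isClosedEmbedding.locallyCompactSpace
  have : SecondCountableTopology L := e.toHomeomorph.secondCountableTopology
  have : LocallyCompactSpace G := S.exp.symm.isClosedEmbedding.locallyCompactSpace
  have : SecondCountableTopology G := S.exp.symm.secondCountableTopology
  set m : Measure (ι → K) := Measure.pi fun _ => Measure.addHaar
  have hm : (m.map e.symm).IsAddHaarMeasure := e.symm.isAddHaarMeasure_map m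
  have hν := S.isHaarMeasure_map_exp b (m.map e.symm)
  have hDc : Continuous (S.toLieGradation.dilation ((ϖ : K) ^ n)) :=
    LinearMap.continuous_of_finiteDimensional _
  have hD : Continuous (S.dil ((ϖ : K) ^ n)) :=
    S.exp.continuous.comp (hDc.comp S.exp.symm.continuous)
  have hF : Measurable fun (x : ι → K) i => ((ϖ : K) ^ n) ^ b.weight i * x i := by fun_prop
  have hem : Measurable e.symm := e.symm.continuous.measurable
  have key : ((m.map e.symm).map S.exp).map (S.dil ((ϖ : K) ^ n)) =
      (residueCard K : ℝ≥0) ^ (n * (S.toLieGradation.homDim : ℤ)) • (m.map e.symm).map S.exp := by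
    rw [Measure.map_map S.exp.measurable hem, Measure.map_map hD.measurable
      (S.exp.measurable.comp hem)]
    -- In exponential coordinates the dilation is diagonal.
    have hcomp : S.dil ((ϖ : K) ^ n) ∘ (S.exp ∘ e.symm) = (S.exp ∘ e.symm) ∘
        fun (x : ι → K) i => ((ϖ : K) ^ n) ^ b.weight i * x i := by
      funext x
      simp only [Function.comp_apply, GradedLieGroup.dil, Homeomorph.symm_apply_apply]
      congr 1
      refine e.injective (funext fun i => ?_)
      rw [e.apply_symm_apply]
      change b.basis.repr _ i = _
      rw [b.repr_dilation]
      congr 1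
      change e (e.symm x) i = x i
      rw [e.apply_symm_apply]
    rw [hcomp, ← Measure.map_map (S.exp.measurable.comp hem) hF, hK.map_pi_mul_zpow hϖ,
      b.homDim_eq, Measure.map_smul]
  -- Haar measures are proportional, so the scaling of one of them suffices.
  rw [Measure.isMulLeftInvariant_eq_smul μ ((m.map e.symm).map S.exp), Measure.map_smul, key,
    smul_comm]

/-! ### The filtration `G_n` and its shells -/

section Dilation

variable {K L G ι : Type*} [NontriviallyNormedField K] [LieRing L] [LieAlgebra K L]
  [TopologicalSpace L] [Group G] [TopologicalSpace G]
  (S : GradedLieGroup K L G) (b : AdaptedBasis S.toLieGradation ι)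

theorem repr_symm_dil (γ : K) (x : G) (i : ι) : b.basis.repr (S.exp.symm (S.dil γ x)) i =
    γ ^ b.weight i * b.basis.repr (S.exp.symm x) i := by
  rw [GradedLieGroup.dil, Homeomorph.symm_apply_apply, b.repr_dilation]

theorem continuous_dil [CompleteSpace K] [T2Space L] [IsTopologicalAddGroup L]
    [ContinuousSMul K L] [Finite ι] (b : AdaptedBasis S.toLieGradation ι) (γ : K) :
    Continuous (S.dil γ) := by
  have : FiniteDimensional K L := b.basis.finiteDimensional_of_finite
  exact S.exp.continuous.comp ((LinearMap.continuous_of_finiteDimensional _).comp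
    S.exp.symm.continuous)

end Dilation

section Filtration

variable {K L G ι : Type*} [NontriviallyNormedField K] [IsUltrametricDist K]
  [LieRing L] [LieAlgebra K L] [TopologicalSpace L] [Group G] [TopologicalSpace G]
  (S : GradedLieGroup K L G) (b : AdaptedBasis S.toLieGradation ι)

theorem mem_filt {n : ℤ} {x : G} : x ∈ filt S b n ↔ ∀ i,
    ‖b.basis.repr (S.exp.symm x) i‖ ≤ (residueCard K : ℝ) ^ (-(n * (b.weight i : ℤ))) := by
  constructor
  · rintro ⟨X, hX, rfl⟩ i
    rw [Homeomorph.symm_apply_apply]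
    exact hX i
  · exact fun h => ⟨S.exp.symm x, h, S.exp.apply_symm_apply x⟩

theorem one_mem_filt (n : ℤ) : (1 : G) ∈ filt S b n := by
  rw [mem_filt, ← S.exp_zero, Homeomorph.symm_apply_apply]
  intro i
  rw [map_zero, Finsupp.zero_apply, norm_zero]
  positivity

theorem filt_anti (hK : IsNormalizedAbs K) : Antitone (filt S b) := by
  intro m n hmn x hx
  rw [mem_filt] at hx ⊢
  intro i
  refine (hx i).trans (zpow_le_zpow_right₀ ?_ ?_)
  · exact_mod_cast hK.one_lt_residueCard.le
  · nlinarith [Int.natCast_nonneg (b.weight i)]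

theorem dil_zpow_mem_filt_iff (hK : IsNormalizedAbs K) {ϖ : Kˣ}
    (hϖ : ‖(ϖ : K)‖ = (residueCard K : ℝ)⁻¹) {k n : ℤ} {x : G} :
    S.dil ((ϖ : K) ^ k) x ∈ filt S b n ↔ x ∈ filt S b (n - k) := by
  have hq : (0 : ℝ) < residueCard K := by
    exact_mod_cast zero_lt_one.trans hK.one_lt_residueCard
  rw [mem_filt, mem_filt]
  refine forall_congr' fun i => ?_
  rw [repr_symm_dil, norm_mul, norm_pow, norm_zpow, hϖ, inv_zpow', ← zpow_natCast, ← zpow_mul,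
    ← mul_le_mul_iff_right₀ (zpow_pos hq (k * (b.weight i : ℤ))), ← mul_assoc,
    ← zpow_add₀ hq.ne', ← zpow_add₀ hq.ne']
  rw [show k * (b.weight i : ℤ) + -k * (b.weight i : ℤ) = 0 by ring, zpow_zero, one_mul,
    show k * (b.weight i : ℤ) + -(n * (b.weight i : ℤ)) = -((n - k) * (b.weight i : ℤ)) by ring]

/-- The shell `G_n ∖ G_{n+1}`. -/
def shell (n : ℤ) : Set G := filt S b n \ filt S b (n + 1)

theorem dil_zpow_mem_shell_iff (hK : IsNormalizedAbs K) {ϖ : Kˣ}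
    (hϖ : ‖(ϖ : K)‖ = (residueCard K : ℝ)⁻¹) {k n : ℤ} {x : G} :
    S.dil ((ϖ : K) ^ k) x ∈ shell S b n ↔ x ∈ shell S b (n - k) := by
  rw [shell, shell, Set.mem_sdiff, Set.mem_sdiff, dil_zpow_mem_filt_iff S b hK hϖ,
    dil_zpow_mem_filt_iff S b hK hϖ, show n + 1 - k = n - k + 1 by ring]

theorem ne_one_of_mem_shell {n : ℤ} {x : G} (hx : x ∈ shell S b n) : x ≠ 1 := by
  rintro rfl
  exact hx.2 (one_mem_filt S b _)

theorem mem_filt_iff_of_mem_shell (hK : IsNormalizedAbs K) {m n : ℤ} {x : G}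
    (hx : x ∈ shell S b m) : x ∈ filt S b n ↔ n ≤ m := by
  refine ⟨fun h => ?_, fun h => filt_anti S b hK h hx.1⟩
  by_contra hlt
  exact hx.2 (filt_anti S b hK (by omega) h)

theorem eq_of_mem_shell (hK : IsNormalizedAbs K) {m n : ℤ} {x : G}
    (hm : x ∈ shell S b m) (hn : x ∈ shell S b n) : m = n :=
  le_antisymm ((mem_filt_iff_of_mem_shell S b hK hn).1 hm.1)
    ((mem_filt_iff_of_mem_shell S b hK hm).1 hn.1)

theorem pairwise_disjoint_shell (hK : IsNormalizedAbs K) :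
    Pairwise (Function.onFun Disjoint (shell S b)) := fun _ _ hmn =>
  Set.disjoint_left.2 fun _ hm hn => hmn (eq_of_mem_shell S b hK hm hn)

/-- The index is the largest `n` with `x ∈ G_n`. Such `n` exist because the coordinates are bounded,
and they are bounded above because some coordinate is nonzero; both use that weights are at least
`1`. -/
theorem exists_mem_shell [Finite ι] (hK : IsNormalizedAbs K) {x : G} (hx : x ≠ 1) :
    ∃ n, x ∈ shell S b n := by
  have hq : (1 : ℝ) < residueCard K := by exact_mod_cast hK.one_lt_residueCard
  have h1 : ∃ N : ℕ, ∀ i, ‖b.basis.repr (S.exp.symm x) i‖ ≤ (residueCard K : ℝ) ^ N := by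
    have : ∀ i, ∃ N : ℕ, ‖b.basis.repr (S.exp.symm x) i‖ < (residueCard K : ℝ) ^ N := fun i =>
      pow_unbounded_of_one_lt _ hq
    choose N hN using this
    obtain ⟨M, hM⟩ := (Set.finite_range N).bddAbove
    exact ⟨M, fun i => (hN i).le.trans (pow_le_pow_right₀ hq.le (hM ⟨i, rfl⟩))⟩
  have h2 : ∃ i, b.basis.repr (S.exp.symm x) i ≠ 0 := by
    by_contra! h
    have : S.exp.symm x = 0 := b.basis.ext_elem fun i => by rw [h i]; simp
    rw [← S.exp_zero, ← this, Homeomorph.apply_symm_apply] at hx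
    exact hx rfl
  obtain ⟨N, hN⟩ := h1
  obtain ⟨i, hi⟩ := h2
  obtain ⟨M, hM⟩ := exists_pow_lt_of_lt_one (norm_pos_iff.2 hi) (inv_lt_one_of_one_lt₀ hq)
  have hw : ∀ i, 1 ≤ (b.weight i : ℤ) := fun i => by
    exact_mod_cast Nat.one_le_iff_ne_zero.2 (b.weight_ne_zero i)
  have hbdd : ∀ n, x ∈ filt S b n → n ≤ M := fun n hn => by
    by_contra hlt
    refine absurd ((mem_filt S b).1 hn i) (not_le.2 (lt_of_le_of_lt ?_ hM))
    rw [inv_pow, ← zpow_natCast, ← zpow_neg]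
    exact zpow_le_zpow_right₀ hq.le (by nlinarith [hw i, Int.natCast_nonneg M])
  have hmem : x ∈ filt S b (-N) := (mem_filt S b).2 fun j => (hN j).trans <| by
    rw [← zpow_natCast]
    exact zpow_le_zpow_right₀ hq.le (by nlinarith [hw j, Int.natCast_nonneg N])
  obtain ⟨n, hn, hmax⟩ := Int.exists_greatest_of_bdd ⟨M, hbdd⟩ ⟨_, hmem⟩
  exact ⟨n, hn, fun h => absurd (hmax _ h) (by omega)⟩

variable [T2Space L] [IsTopologicalAddGroup L] [ContinuousSMul K L]

theorem filt_eq_preimage [CompleteSpace K] [Fintype ι] (n : ℤ) : filt S b n =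
    (S.exp.symm.trans b.basis.equivFunL.toHomeomorph) ⁻¹' (Set.univ.pi fun i =>
      Metric.closedBall 0 ((residueCard K : ℝ) ^ (-(n * (b.weight i : ℤ))))) := by
  ext x
  rw [mem_filt]
  simp only [Set.mem_preimage, Set.mem_pi, Set.mem_univ, true_implies, mem_closedBall_zero_iff]
  rfl

variable [LocallyCompactSpace K]

theorem isCompact_filt [Fintype ι] (n : ℤ) : IsCompact (filt S b n) := by
  have : ProperSpace K := ProperSpace.of_locallyCompactSpace K
  rw [filt_eq_preimage, Homeomorph.isCompact_preimage]
  exact isCompact_univ_pi fun i => isCompact_closedBall _ _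

theorem isOpen_filt [Fintype ι] (hK : IsNormalizedAbs K) (n : ℤ) : IsOpen (filt S b n) := by
  have : ProperSpace K := ProperSpace.of_locallyCompactSpace K
  have hq : (residueCard K : ℝ) ≠ 0 := by
    exact_mod_cast (zero_lt_one.trans hK.one_lt_residueCard).ne'
  rw [filt_eq_preimage]
  refine (isOpen_set_pi Set.finite_univ fun i _ => ?_).preimage (Homeomorph.continuous _)
  exact IsUltrametricDist.isOpen_closedBall _ (zpow_ne_zero _ hq)

/-- Each `G_n` is both compact and open. Compact shells avoid `e`, so functions continuous off `e`
are bounded on them. -/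
theorem isCompact_shell [Fintype ι] (hK : IsNormalizedAbs K) (n : ℤ) :
    IsCompact (shell S b n) :=
  (isCompact_filt S b n).diff (isOpen_filt S b hK _)

theorem isOpen_shell [Fintype ι] (hK : IsNormalizedAbs K) (n : ℤ) : IsOpen (shell S b n) := by
  have : T2Space G := S.exp.symm.isEmbedding.t2Space
  exact (isOpen_filt S b hK n).sdiff (isCompact_filt S b _).isClosed

variable [MeasurableSpace G] [BorelSpace G] [Fintype ι]

theorem measurableSet_filt (hK : IsNormalizedAbs K) (n : ℤ) : MeasurableSet (filt S b n) :=
  (isOpen_filt S b hK n).measurableSet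

theorem measurableSet_shell (hK : IsNormalizedAbs K) (n : ℤ) : MeasurableSet (shell S b n) :=
  (isOpen_shell S b hK n).measurableSet

end Filtration

/-! ### Integrals over shells -/

section Measure

variable {K L G ι : Type*} [NontriviallyNormedField K] [IsUltrametricDist K]
  [LocallyCompactSpace K] (hK : IsNormalizedAbs K)
  [LieRing L] [LieAlgebra K L] [TopologicalSpace L] [T2Space L] [IsTopologicalAddGroup L]
  [ContinuousSMul K L] [Group G] [TopologicalSpace G] [IsTopologicalGroup G] [MeasurableSpace G]
  [BorelSpace G] [Nontrivial G] (S : GradedLieGroup K L G) [Fintype ι]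
  (b : AdaptedBasis S.toLieGradation ι) (μ : Measure G) [μ.IsHaarMeasure] {ϖ : Kˣ}
  (hϖ : ‖(ϖ : K)‖ = (residueCard K : ℝ)⁻¹)

theorem IsNormalizedAbs.natCast_ne_zero {K : Type*} [NontriviallyNormedField K]
    [IsUltrametricDist K] (hK : IsNormalizedAbs K) : (residueCard K : ℝ≥0∞) ≠ 0 := by
  exact_mod_cast (zero_lt_one.trans hK.one_lt_residueCard).ne'

theorem homDim_pos {K L G ι : Type*} [NontriviallyNormedField K] [LieRing L] [LieAlgebra K L]
    [TopologicalSpace L] [Group G] [TopologicalSpace G] [Nontrivial G]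
    (S : GradedLieGroup K L G) [Fintype ι] (b : AdaptedBasis S.toLieGradation ι) :
    0 < S.toLieGradation.homDim := by
  rw [b.homDim_eq]
  have : Nonempty ι := by
    by_contra h
    rw [not_nonempty_iff] at h
    have : Subsingleton L := ⟨fun X Y => b.basis.ext_elem fun i => h.elim i⟩
    have : Subsingleton G := S.exp.symm.injective.subsingleton
    exact not_subsingleton G this
  exact Finset.sum_pos (fun i _ => Nat.pos_of_ne_zero (b.weight_ne_zero i))
    Finset.univ_nonempty

include hK hϖ b in
theorem lintegral_comp_dil {h : G → ℝ≥0∞} (hh : Measurable h) (n : ℤ) :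
    ∫⁻ x, h (S.dil ((ϖ : K) ^ n) x) ∂μ =
      (residueCard K : ℝ≥0∞) ^ (n * S.toLieGradation.homDim : ℝ) * ∫⁻ x, h x ∂μ := by
  have : ProperSpace K := ProperSpace.of_locallyCompactSpace K
  have hq : (residueCard K : ℝ≥0) ≠ 0 := by
    exact_mod_cast (zero_lt_one.trans hK.one_lt_residueCard).ne'
  rw [← lintegral_map hh (continuous_dil S b _).measurable, S.map_dil hK b μ hϖ,
    lintegral_smul_measure, ENNReal.smul_def, smul_eq_mul]
  congr 1
  rw [← NNReal.rpow_intCast, ENNReal.coe_rpow_of_ne_zero hq]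
  push_cast
  rfl

include hK hϖ in
-- Change of variables by the dilation `ϖ^n`, which carries shell `0` onto shell `n`. Since `|ϖ| =
-- q⁻¹`, the number `d` is minus the degree of homogeneity of `h`.
theorem setLIntegral_shell {h : G → ℝ≥0∞} (hh : Measurable h) {d : ℝ}
    (hd : ∀ n : ℤ, ∀ x, x ≠ 1 → h (S.dil ((ϖ : K) ^ n) x) =
      (residueCard K : ℝ≥0∞) ^ (n * d : ℝ) * h x) (n : ℤ) :
    ∫⁻ x in shell S b n, h x ∂μ =
      (residueCard K : ℝ≥0∞) ^ (n * (d - S.toLieGradation.homDim) : ℝ) *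
        ∫⁻ x in shell S b 0, h x ∂μ := by
  have hE := measurableSet_shell S b hK
  have h1 := lintegral_comp_dil hK S b μ hϖ (hh.indicator (hE n)) n
  rw [lintegral_indicator (hE n)] at h1
  have h2 : ∀ x, (shell S b n).indicator h (S.dil ((ϖ : K) ^ n) x) =
      (shell S b 0).indicator (fun x => (residueCard K : ℝ≥0∞) ^ (n * d : ℝ) * h x) x := by
    intro x
    have h3 := dil_zpow_mem_shell_iff S b hK hϖ (k := n) (n := n) (x := x)
    rw [sub_self] at h3
    by_cases hx : x ∈ shell S b 0
    · rw [Set.indicator_of_mem (h3.2 hx), Set.indicator_of_mem hx,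
        hd n x (ne_one_of_mem_shell S b hx)]
    · rw [Set.indicator_of_notMem (fun h4 => hx (h3.1 h4)), Set.indicator_of_notMem hx]
  simp_rw [h2] at h1
  rw [lintegral_indicator (hE 0), lintegral_const_mul _ hh] at h1
  have hq0 := hK.natCast_ne_zero
  have hq1 : (residueCard K : ℝ≥0∞) ≠ ⊤ := ENNReal.natCast_ne_top _
  rw [show (n * (d - S.toLieGradation.homDim) : ℝ) =
    -(n * S.toLieGradation.homDim : ℝ) + n * d by ring, ENNReal.rpow_add _ _ hq0 hq1, mul_assoc,
    h1, ← mul_assoc, ← ENNReal.rpow_add _ _ hq0 hq1, neg_add_cancel, ENNReal.rpow_zero, one_mul]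

include hK hϖ in
theorem measure_filt (hμ : μ (filt S b 0) = 1) (n : ℤ) : μ (filt S b n) =
    (residueCard K : ℝ≥0∞) ^ (-(n * S.toLieGradation.homDim) : ℝ) := by
  have h1 := lintegral_comp_dil hK S b μ hϖ
    ((measurable_one (α := ℝ≥0∞)).indicator (measurableSet_filt S b hK n)) n
  rw [lintegral_indicator_one (measurableSet_filt S b hK n)] at h1
  have h2 : ∀ x, (filt S b n).indicator (1 : G → ℝ≥0∞) (S.dil ((ϖ : K) ^ n) x) =
      (filt S b 0).indicator (1 : G → ℝ≥0∞) x := by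
    intro x
    have h3 := dil_zpow_mem_filt_iff S b hK hϖ (k := n) (n := n) (x := x)
    rw [sub_self] at h3
    by_cases hx : x ∈ filt S b 0
    · rw [Set.indicator_of_mem (h3.2 hx), Set.indicator_of_mem hx]; rfl
    · rw [Set.indicator_of_notMem (fun h4 => hx (h3.1 h4)), Set.indicator_of_notMem hx]
  simp_rw [h2] at h1
  rw [lintegral_indicator_one (measurableSet_filt S b hK 0), hμ] at h1
  rw [ENNReal.rpow_neg]
  exact ENNReal.eq_inv_of_mul_eq_one_left (by rw [mul_comm]; exact h1.symm)

include hK in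
theorem gnorm_of_mem_shell (hμ : μ (filt S b 0) = 1) {n : ℤ} {x : G} (hx : x ∈ shell S b n) :
    gnorm S b μ x = (residueCard K : ℝ) ^ (-n) := by
  obtain ⟨ϖ, hϖ⟩ := hK.exists_uniformizer
  have h : ∃ n : ℤ, x ∈ filt S b n \ filt S b (n + 1) := ⟨n, hx⟩
  have hn : h.choose = n := eq_of_mem_shell S b hK h.choose_spec hx
  have hQ : (S.toLieGradation.homDim : ℝ) ≠ 0 := by exact_mod_cast (homDim_pos S b).ne'
  rw [gnorm, dif_pos h, hn, measure_filt hK S b μ hϖ hμ, ← ENNReal.toReal_rpow,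
    ENNReal.toReal_natCast, ← Real.rpow_mul (Nat.cast_nonneg _), ← Real.rpow_intCast]
  congr 1
  push_cast
  field_simp

theorem gnorm_one {K L G ι : Type*} [NontriviallyNormedField K] [IsUltrametricDist K]
    [LieRing L] [LieAlgebra K L] [TopologicalSpace L] [Group G] [TopologicalSpace G]
    [MeasurableSpace G] (S : GradedLieGroup K L G) (b : AdaptedBasis S.toLieGradation ι)
    (μ : Measure G) : gnorm S b μ 1 = 0 := by
  rw [gnorm, dif_neg]
  rintro ⟨n, hn⟩
  exact hn.2 (one_mem_filt S b _)

include hK in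
-- The quasi-norm is `q^{-n}` on shell `n`, strictly decreasing in `n`.
theorem gball_gnorm_of_mem_shell (hμ : μ (filt S b 0) = 1) {n : ℤ} {x : G}
    (hx : x ∈ shell S b n) : gball S b μ (gnorm S b μ x) = filt S b n := by
  have hq : (1 : ℝ) < residueCard K := by exact_mod_cast hK.one_lt_residueCard
  ext y
  rw [gball, Set.mem_ofPred_eq, gnorm_of_mem_shell hK S b μ hμ hx]
  by_cases hy : y = 1
  · rw [hy, gnorm_one]
    exact iff_of_true (by positivity) (one_mem_filt S b n)
  · obtain ⟨m, hm⟩ := exists_mem_shell S b hK hy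
    rw [gnorm_of_mem_shell hK S b μ hμ hm, mem_filt_iff_of_mem_shell S b hK hm,
      zpow_le_zpow_iff_right₀ hq, neg_le_neg_iff]

include hK b in
-- The identity lies in every `G_n`, and `|G_n| = q^{-nQ}` tends to `0` because `Q > 0`. Hence the
-- shells exhaust `G` up to a null set.
theorem measure_singleton_one (hμ : μ (filt S b 0) = 1) : μ {1} = 0 := by
  obtain ⟨ϖ, hϖ⟩ := hK.exists_uniformizer
  have hq : (1 : ℝ≥0∞) < residueCard K := by exact_mod_cast hK.one_lt_residueCard
  have hlt : ((residueCard K : ℝ≥0∞) ^ (S.toLieGradation.homDim : ℝ))⁻¹ < 1 := by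
    rw [ENNReal.inv_lt_one]
    exact ENNReal.one_lt_rpow hq (by exact_mod_cast homDim_pos S b)
  refine le_antisymm (ge_of_tendsto' (ENNReal.tendsto_pow_atTop_nhds_zero_of_lt_one hlt)
    fun n => ?_) zero_le
  refine (measure_mono (Set.singleton_subset_iff.2 (one_mem_filt S b (n : ℤ)))).trans_eq ?_
  rw [measure_filt hK S b μ hϖ hμ, ← ENNReal.rpow_neg, ← ENNReal.rpow_natCast,
    ← ENNReal.rpow_mul]
  congr 1
  push_cast
  ring

include hK in
theorem lintegral_eq_tsum_shell (hμ : μ (filt S b 0) = 1) (f : G → ℝ≥0∞) :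
    ∫⁻ x, f x ∂μ = ∑' n, ∫⁻ x in shell S b n, f x ∂μ := by
  rw [← lintegral_iUnion (measurableSet_shell S b hK) (pairwise_disjoint_shell S b hK),
    Measure.restrict_eq_self_of_ae_mem]
  filter_upwards [compl_mem_ae_iff.2 (measure_singleton_one hK S b μ hμ)] with x hx
  exact Set.mem_iUnion.2 (exists_mem_shell S b hK hx)

include hK in
theorem setLIntegral_compl_filt (hμ : μ (filt S b 0) = 1) (f : G → ℝ≥0∞) (n : ℤ) :
    ∫⁻ x in (filt S b n)ᶜ, f x ∂μ =
      ∑' m, if m < n then ∫⁻ x in shell S b m, f x ∂μ else 0 := by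
  have hF := (measurableSet_filt S b hK n).compl
  rw [← lintegral_indicator hF, lintegral_eq_tsum_shell hK S b μ hμ]
  refine tsum_congr fun m => ?_
  split_ifs with hmn
  · refine setLIntegral_congr_fun (measurableSet_shell S b hK m) fun x hx => ?_
    rw [Set.indicator_of_mem]
    exact fun h => absurd ((mem_filt_iff_of_mem_shell S b hK hx).1 h) (not_le.2 hmn)
  · rw [setLIntegral_congr_fun (g := fun _ => 0) (measurableSet_shell S b hK m) fun x hx => ?_,
      lintegral_zero]
    rw [Set.indicator_of_notMem]
    exact fun h => h ((mem_filt_iff_of_mem_shell S b hK hx).2 (not_lt.1 hmn))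

include hK in
-- The inner integral depends on `x` only through its shell; this is the passage from `G` to `ℤ`.
theorem lintegral_hardy_eq_tsum (hμ : μ (filt S b 0) = 1) (f : G → ℝ≥0∞) {w : G → ℝ≥0∞}
    (hw : Measurable w) (s : ℝ) :
    ∫⁻ x, (∫⁻ z in (gball S b μ (gnorm S b μ x))ᶜ, f z ∂μ) ^ s * w x ∂μ =
      ∑' n, (∑' m, if m < n then ∫⁻ z in shell S b m, f z ∂μ else 0) ^ s *
        ∫⁻ x in shell S b n, w x ∂μ := by
  rw [lintegral_eq_tsum_shell hK S b μ hμ]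
  refine tsum_congr fun n => ?_
  rw [← lintegral_const_mul _ hw]
  refine setLIntegral_congr_fun (measurableSet_shell S b hK n) fun x hx => ?_
  rw [gball_gnorm_of_mem_shell hK S b μ hμ hx, setLIntegral_compl_filt hK S b μ hμ]

end Measure

/-! ### Discrete inequalities and Hölder's inequality with a weight -/

theorem tsum_rpow_le_rpow_tsum {ι : Type*} (x : ι → ℝ≥0∞) {p : ℝ} (hp : 1 ≤ p) :
    ∑' i, x i ^ p ≤ (∑' i, x i) ^ p := by
  have h : ∀ y : ℝ≥0∞, y ^ p = y * y ^ (p - 1) := fun y => by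
    conv_rhs => rw [← ENNReal.rpow_one y, ← ENNReal.rpow_mul, one_mul]
    rw [← ENNReal.rpow_add_of_nonneg _ _ zero_le_one (by linarith)]
    congr 1
    ring
  rw [h, ← ENNReal.tsum_mul_right]
  refine ENNReal.tsum_le_tsum fun i => ?_
  rw [h]
  exact mul_le_mul_right (ENNReal.rpow_le_rpow (ENNReal.le_tsum i) (by linarith)) _

theorem tsum_mul_le_Lp_mul_Lq {ι : Type*} [Countable ι] (x y : ι → ℝ≥0∞) {p q : ℝ}
    (hpq : p.HolderConjugate q) :
    ∑' i, x i * y i ≤ (∑' i, x i ^ p) ^ (1 / p) * (∑' i, y i ^ q) ^ (1 / q) := by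
  let _ : MeasurableSpace ι := ⊤
  have := ENNReal.lintegral_mul_le_Lp_mul_Lq Measure.count hpq
    (measurable_of_countable x).aemeasurable (measurable_of_countable y).aemeasurable
  simpa only [lintegral_count, Pi.mul_apply] using this

/-- Young's convolution inequality on `ℤ`. -/
theorem tsum_conv_rpow_le (κ B : ℤ → ℝ≥0∞) {r r' : ℝ} (hr : r.HolderConjugate r') :
    ∑' n, (∑' m, κ (n - m) * B m) ^ r ≤ (∑' j, κ j) ^ r * ∑' m, B m ^ r := by
  have hr0 : 0 < r := hr.pos
  have hr0' : 0 < r' := hr.symm.pos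
  have hinv := hr.inv_add_inv_eq_one
  have hW : ∀ n, ∑' m, κ (n - m) = ∑' j, κ j := fun n =>
    (Equiv.subLeft n).tsum_eq κ
  have hW' : ∀ m, ∑' n, κ (n - m) = ∑' j, κ j := fun m =>
    (Equiv.subRight m).tsum_eq κ
  set W := ∑' j, κ j
  have hpt : ∀ n, (∑' m, κ (n - m) * B m) ^ r ≤
      W ^ (r / r') * ∑' m, κ (n - m) * B m ^ r := by
    intro n
    -- Hölder is applied with respect to the mass `κ (n - m)`, whose total `W` does not depend on
    -- `n`.
    have h1 : ∀ m, κ (n - m) * B m =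
        κ (n - m) ^ (1 / r') * (κ (n - m) ^ (1 / r) * B m) := fun m => by
      rw [← mul_assoc, ← ENNReal.rpow_add_of_nonneg _ _ (by positivity) (by positivity),
        one_div, one_div, add_comm, hinv, ENNReal.rpow_one]
    simp_rw [h1]
    refine (ENNReal.rpow_le_rpow (tsum_mul_le_Lp_mul_Lq _ _ hr.symm) hr0.le).trans_eq ?_
    rw [ENNReal.mul_rpow_of_nonneg _ _ hr0.le, ← ENNReal.rpow_mul, ← ENNReal.rpow_mul,
      one_div_mul_cancel hr0.ne', ENNReal.rpow_one]
    congr 1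
    · rw [← hW n]
      congr 1
      · refine tsum_congr fun m => ?_
        rw [← ENNReal.rpow_mul, one_div_mul_cancel hr0'.ne', ENNReal.rpow_one]
      · ring
    · refine tsum_congr fun m => ?_
      rw [ENNReal.mul_rpow_of_nonneg _ _ hr0.le, ← ENNReal.rpow_mul,
        one_div_mul_cancel hr0.ne', ENNReal.rpow_one]
  calc ∑' n, (∑' m, κ (n - m) * B m) ^ r
      ≤ ∑' n, W ^ (r / r') * ∑' m, κ (n - m) * B m ^ r := ENNReal.tsum_le_tsum hpt
    _ = W ^ (r / r') * ∑' m, ∑' n, κ (n - m) * B m ^ r := by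
        rw [ENNReal.tsum_mul_left, ENNReal.tsum_comm]
    _ = W ^ (r / r') * (W * ∑' m, B m ^ r) := by
        simp_rw [ENNReal.tsum_mul_right, hW', ENNReal.tsum_mul_left]
    _ = W ^ r * ∑' m, B m ^ r := by
        rw [← mul_assoc]
        congr 1
        conv_lhs => rw [← ENNReal.rpow_one W, ← ENNReal.rpow_mul, one_mul]
        rw [← ENNReal.rpow_add_of_nonneg _ _ (by positivity) zero_le_one]
        congr 1
        rw [div_eq_mul_inv]
        have : r * r⁻¹ = 1 := mul_inv_cancel₀ hr0.ne'
        have h3 : r'⁻¹ = 1 - r⁻¹ := by linarith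
        rw [h3]
        linarith

/-- The geometric kernel on the positive integers has finite mass. -/
theorem tsum_geometric_pos_ne_top {q : ℝ≥0∞} (hq : 1 < q) {t : ℝ} (ht : 0 < t) :
    ∑' j : ℤ, (if 0 < j then q ^ (-(j * t) : ℝ) else 0) ≠ ⊤ := by
  have hinj : Function.Injective fun k : ℕ => (k : ℤ) + 1 := fun a c h => by
    simpa using h
  rw [← hinj.tsum_eq]
  · have h1 : ∀ k : ℕ, (if 0 < (k : ℤ) + 1 then q ^ (-((((k : ℤ) + 1 : ℤ) : ℝ) * t)) else 0) =
        (q ^ (-t)) ^ (k + 1) := fun k => by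
      rw [if_pos (by positivity), ← ENNReal.rpow_natCast, ← ENNReal.rpow_mul]
      congr 1
      push_cast
      ring
    have h2 : q ^ (-t) < 1 := by
      rw [ENNReal.rpow_neg, ENNReal.inv_lt_one]
      exact ENNReal.one_lt_rpow hq ht
    simp_rw [h1]
    rw [ENNReal.tsum_geometric_add_one]
    refine ENNReal.mul_ne_top h2.ne_top (ENNReal.inv_ne_top.2 ?_)
    exact (tsub_pos_of_lt h2).ne'
  · intro j hj
    rw [Function.mem_support] at hj
    have : 0 < j := by
      by_contra h
      exact hj (if_neg h)
    exact ⟨(j - 1).toNat, by simp; omega⟩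

/-- The weighted discrete Hardy inequality, from `ℓ^r` to `ℓ^s`. -/
theorem tsum_hardy_le {q : ℝ≥0∞} (hq : 1 < q) (hq' : q ≠ ⊤) {t r r' s : ℝ}
    (hr : r.HolderConjugate r') (hrs : r ≤ s) {F B : ℤ → ℝ≥0∞}
    (hF : ∀ m : ℤ, F m ≤ q ^ (m * t : ℝ) * B m) :
    ∑' n : ℤ, (∑' m, if m < n then F m else 0) ^ s * q ^ (-(n * (t * s)) : ℝ) ≤
      (∑' j : ℤ, (if 0 < j then q ^ (-(j * t) : ℝ) else 0)) ^ s * (∑' m, B m ^ r) ^ (s / r) := by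
  have hr0 : 0 < r := hr.pos
  have hs0 : 0 < s := hr0.trans_le hrs
  have hq0 : q ≠ 0 := (zero_lt_one.trans hq).ne'
  set κ : ℤ → ℝ≥0∞ := fun j => if 0 < j then q ^ (-(j * t) : ℝ) else 0 with hκ
  -- Moved inside the `s`-th power, the weight is `q^{-nt}`; with `q^{mt}` from `hF` it forms the
  -- kernel `q^{-(n-m)t}`. Writing `s = r · (s / r)` prepares for Young in `ℓ^r` followed by `ℓ^r ⊆
  -- ℓ^s`.
  have h1 : ∀ n : ℤ, (∑' m, if m < n then F m else 0) ^ s * q ^ (-(n * (t * s)) : ℝ) ≤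
      ((∑' m, κ (n - m) * B m) ^ r) ^ (s / r) := by
    intro n
    rw [← ENNReal.rpow_mul, mul_div_cancel₀ _ hr0.ne',
      show (-(n * (t * s)) : ℝ) = -(n * t) * s by ring, ENNReal.rpow_mul q,
      ← ENNReal.mul_rpow_of_nonneg _ _ hs0.le, ← ENNReal.tsum_mul_right]
    refine ENNReal.rpow_le_rpow (ENNReal.tsum_le_tsum fun m => ?_) hs0.le
    simp only [hκ, sub_pos]
    split_ifs with hmn
    · calc F m * q ^ (-(n * t) : ℝ) ≤ q ^ (m * t : ℝ) * B m * q ^ (-(n * t) : ℝ) := by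
            gcongr; exact hF m
        _ = q ^ (m * t : ℝ) * q ^ (-(n * t) : ℝ) * B m := by ring
        _ = _ := by
            rw [← ENNReal.rpow_add _ _ hq0 hq']
            congr 2
            push_cast
            ring
    · simp
  calc _ ≤ ∑' n : ℤ, ((∑' m, κ (n - m) * B m) ^ r) ^ (s / r) := ENNReal.tsum_le_tsum h1
    _ ≤ (∑' n : ℤ, (∑' m, κ (n - m) * B m) ^ r) ^ (s / r) :=
        tsum_rpow_le_rpow_tsum _ ((one_le_div hr0).2 hrs)
    _ ≤ ((∑' j, κ j) ^ r * ∑' m, B m ^ r) ^ (s / r) :=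
        ENNReal.rpow_le_rpow (tsum_conv_rpow_le κ B hr) (by positivity)
    _ = _ := by
        rw [ENNReal.mul_rpow_of_nonneg _ _ (by positivity), ← ENNReal.rpow_mul,
          mul_div_cancel₀ _ hr0.ne']

/-- For `δ ≠ 0` the powers blow up as `m → ∞` or as `m → -∞`, according to the sign of `δ`. -/
theorem eq_zero_of_rpow_le {q M : ℝ≥0∞} (hq : 1 < q) (hM : M ≠ ⊤) {δ : ℝ}
    (h : ∀ m : ℤ, q ^ (m * δ : ℝ) ≤ M) : δ = 0 := by
  have key : ∀ ε : ℝ, 0 < ε → ¬ ∀ m : ℕ, q ^ (m * ε : ℝ) ≤ M := fun ε hε h' => by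
    have h1 : 1 < q ^ ε := ENNReal.one_lt_rpow hq hε
    have h2 : (q ^ ε)⁻¹ < 1 := ENNReal.inv_lt_one.2 h1
    have h3 := ENNReal.tendsto_pow_atTop_nhds_zero_of_lt_one h2
    refine hM (ENNReal.inv_eq_zero.1 (le_antisymm (ge_of_tendsto' h3 fun n => ?_) zero_le))
    rw [← ENNReal.inv_pow, ENNReal.inv_le_inv, ← ENNReal.rpow_natCast, ← ENNReal.rpow_mul,
      mul_comm]
    exact h' n
  rcases lt_trichotomy δ 0 with hδ | hδ | hδ
  · refine absurd (fun m => ?_) (key (-δ) (by linarith))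
    have := h (-m)
    push_cast at this
    rwa [neg_mul, ← mul_neg] at this
  · exact hδ
  · exact absurd (fun m => by exact_mod_cast h m) (key δ hδ)

/-- Hölder for `f = (f w^{1/r}) · w^{-1/r}`, with `r' / r = r' - 1`. The factorisation holds almost
everywhere because finiteness of the integral of `w^{1-r'}` forces `w > 0` almost everywhere. -/
theorem setLIntegral_le_weighted {G : Type*} [MeasurableSpace G] {μ : Measure G} {r r' : ℝ}
    (hr : r.HolderConjugate r') {f w : G → ℝ≥0∞} (hf : AEMeasurable f μ) (hw : Measurable w)
    (hwt : ∀ x, w x ≠ ⊤) (hfin : ∫⁻ x, w x ^ (1 - r') ∂μ ≠ ⊤) :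
    ∫⁻ x, f x ∂μ ≤ (∫⁻ x, f x ^ r * w x ∂μ) ^ (1 / r) *
      (∫⁻ x, w x ^ (1 - r') ∂μ) ^ (1 / r') := by
  have hr0 : 0 < r := hr.pos
  have hr1 : 1 < r' := hr.symm.lt
  have hinv := hr.inv_add_inv_eq_one
  have hae : ∀ᵐ x ∂μ, f x = (f x * w x ^ (1 / r)) * w x ^ (-(1 / r)) := by
    filter_upwards [ae_lt_top (hw.pow_const _) hfin] with x hx
    have h0 : w x ≠ 0 := by
      intro h
      rw [h, ENNReal.zero_rpow_of_neg (by linarith)] at hx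
      exact lt_irrefl _ hx
    rw [mul_assoc, ← ENNReal.rpow_add _ _ h0 (hwt x), add_neg_cancel, ENNReal.rpow_zero, mul_one]
  rw [lintegral_congr_ae hae]
  refine (ENNReal.lintegral_mul_le_Lp_mul_Lq μ hr (hf.mul (hw.pow_const _).aemeasurable)
    (hw.pow_const _).aemeasurable).trans_eq ?_
  congr 2
  · refine lintegral_congr fun x => ?_
    rw [Pi.mul_apply, ENNReal.mul_rpow_of_nonneg _ _ hr0.le, ← ENNReal.rpow_mul,
      one_div_mul_cancel hr0.ne', ENNReal.rpow_one]
  · refine lintegral_congr fun x => ?_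
    rw [← ENNReal.rpow_mul]
    congr 1
    have h2 : r⁻¹ = 1 - r'⁻¹ := by linarith
    have h3 : r'⁻¹ * r' = 1 := inv_mul_cancel₀ (by linarith)
    rw [one_div, h2]
    linarith

/-! ### The Hardy inequality and the critical relation -/

section Hardy

variable {K L G ι : Type*} [NontriviallyNormedField K] [IsUltrametricDist K]
  [LocallyCompactSpace K] (hK : IsNormalizedAbs K)
  [LieRing L] [LieAlgebra K L] [TopologicalSpace L] [T2Space L] [IsTopologicalAddGroup L]
  [ContinuousSMul K L] [Group G] [TopologicalSpace G] [MeasurableSpace G]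
  (S : GradedLieGroup K L G) [Fintype ι]
  (b : AdaptedBasis S.toLieGradation ι) (μ : Measure G) [μ.IsHaarMeasure]

theorem GradedLieGroup.IsHomogeneous.ofReal_dil {K L G : Type*} [NontriviallyNormedField K]
    [IsUltrametricDist K] (hK : IsNormalizedAbs K) [LieRing L] [LieAlgebra K L]
    [TopologicalSpace L] [Group G] [TopologicalSpace G] {S : GradedLieGroup K L G} {φ : G → ℝ}
    {d : ℝ} (hφ : S.IsHomogeneous φ d) {ϖ : Kˣ} (hϖ : ‖(ϖ : K)‖ = (residueCard K : ℝ)⁻¹)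
    (n : ℤ) {x : G} (hx : x ≠ 1) :
    ENNReal.ofReal (φ (S.dil ((ϖ : K) ^ n) x)) =
      (residueCard K : ℝ≥0∞) ^ (n * -d : ℝ) * ENNReal.ofReal (φ x) := by
  have hq : (0 : ℝ) < residueCard K := by
    exact_mod_cast zero_lt_one.trans hK.one_lt_residueCard
  rw [hφ _ (zpow_ne_zero n ϖ.ne_zero) x hx, norm_zpow, hϖ, inv_zpow', ← Real.rpow_intCast,
    ← Real.rpow_mul hq.le, ENNReal.ofReal_mul (by positivity), ← ENNReal.ofReal_rpow_of_pos hq,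
    ENNReal.ofReal_natCast]
  congr 2
  push_cast
  ring

include hK in
theorem setLIntegral_ne_top_of_continuousOn {φ : G → ℝ} (hφc : ContinuousOn φ {1}ᶜ) :
    ∫⁻ x in shell S b 0, ENNReal.ofReal (φ x) ∂μ ≠ ⊤ := by
  have hc := isCompact_shell S b hK 0
  obtain ⟨M, hM⟩ := (hc.image_of_continuousOn
    (hφc.mono fun z hz => ne_one_of_mem_shell S b hz)).bddAbove
  refine ne_top_of_le_ne_top (ENNReal.mul_ne_top (ENNReal.ofReal_ne_top (r := M)) hc.measure_ne_top)
    ((setLIntegral_mono measurable_const fun x hx =>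
      ENNReal.ofReal_le_ofReal (hM ⟨x, hx, rfl⟩)).trans_eq (setLIntegral_const _ _))

include hK in
theorem measure_shell_zero_ne_zero [Nontrivial G] : μ (shell S b 0) ≠ 0 := by
  obtain ⟨ϖ, hϖ⟩ := hK.exists_uniformizer
  obtain ⟨x, hx⟩ := exists_ne (1 : G)
  obtain ⟨n, hn⟩ := exists_mem_shell S b hK hx
  refine ((isOpen_shell S b hK 0).measure_pos μ ⟨S.dil ((ϖ : K) ^ (-n)) x, ?_⟩).ne'
  rw [dil_zpow_mem_shell_iff S b hK hϖ]
  simpa using hn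

variable [BorelSpace G]

include hK in
-- A point where `φ > 0` is dilated into shell `0`; by homogeneity and continuity `φ` is positive on
-- a nonempty open subset of that shell.
theorem setLIntegral_ne_zero_of_ne_zero [Nontrivial G] {φ : G → ℝ} (hφ0 : ∀ x, 0 ≤ φ x)
    (hφc : ContinuousOn φ {1}ᶜ) {d : ℝ} (hφh : S.IsHomogeneous φ d)
    (hφ : ∃ x, x ≠ 1 ∧ φ x ≠ 0) :
    ∫⁻ x in shell S b 0, ENNReal.ofReal (φ x) ∂μ ≠ 0 := by
  obtain ⟨ϖ, hϖ⟩ := hK.exists_uniformizer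
  have : T2Space G := S.exp.symm.isEmbedding.t2Space
  have hq := hK.natCast_ne_zero
  obtain ⟨x, hx1, hx⟩ := hφ
  obtain ⟨n, hn⟩ := exists_mem_shell S b hK hx1
  set y := S.dil ((ϖ : K) ^ (-n)) x with hy
  have hyE : y ∈ shell S b 0 := by
    rw [hy, dil_zpow_mem_shell_iff S b hK hϖ]
    simpa using hn
  have hyφ : 0 < φ y := by
    rw [← ENNReal.ofReal_pos, hy, hφh.ofReal_dil hK hϖ _ hx1]
    exact ENNReal.mul_pos (ENNReal.rpow_pos (pos_iff_ne_zero.2 hq) (ENNReal.natCast_ne_top _)).ne'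
      (ENNReal.ofReal_pos.2 ((hφ0 x).lt_of_ne' hx)).ne'
  have hm : Measurable φ := measurable_of_continuousOn_compl_singleton 1 hφc
  have hU : IsOpen (shell S b 0 ∩ φ ⁻¹' Set.Ioi 0) :=
    (hφc.mono fun z hz => ne_one_of_mem_shell S b hz).isOpen_inter_preimage
      (isOpen_shell S b hK 0) isOpen_Ioi
  have hpos := hU.measure_pos μ ⟨y, hyE, hyφ⟩
  intro h
  rw [lintegral_eq_zero_iff hm.ennreal_ofReal, Filter.EventuallyEq,
    ae_restrict_iff' (measurableSet_shell S b hK 0)] at h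
  refine hpos.ne' (measure_mono_null (fun z hz => ?_) (ae_iff.1 h))
  intro hz'
  have h2 := hz' hz.1
  rw [Pi.zero_apply, ENNReal.ofReal_eq_zero] at h2
  exact absurd hz.2 (not_lt.2 h2)

variable [IsTopologicalGroup G] [Nontrivial G] (hμ : μ (filt S b 0) = 1) {α β r r' s : ℝ} (hr : r.HolderConjugate r')
  (hrs : r ≤ s) {φ ψ : G → ℝ}
  (hφc : ContinuousOn φ {1}ᶜ) (hψc : ContinuousOn ψ {1}ᶜ)
  (hφh : S.IsHomogeneous φ (-α)) (hψh : S.IsHomogeneous ψ β)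

include hK hμ hr hrs hφc hψc hφh hψh in
/-- The weighted Hardy inequality at the critical homogeneity. -/
theorem exists_hardy_const (hα : α < S.toLieGradation.homDim)
    (hψ : ∫⁻ x in shell S b 0, ENNReal.ofReal (ψ x) ^ (1 - r') ∂μ ≠ ⊤)
    (hcrit : (α - S.toLieGradation.homDim) / s = S.toLieGradation.homDim / r' - β / r) :
    ∃ C : NNReal, ∀ f : G → ℝ, AEMeasurable f μ →
      (∫⁻ x, (∫⁻ z in (gball S b μ (gnorm S b μ x))ᶜ, ENNReal.ofReal (f z) ∂μ) ^ s *
          ENNReal.ofReal (φ x) ∂μ) ^ (1 / s) ≤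
        C * (∫⁻ x, ENNReal.ofReal (f x) ^ r * ENNReal.ofReal (ψ x) ∂μ) ^ (1 / r) := by
  obtain ⟨ϖ, hϖ⟩ := hK.exists_uniformizer
  have : T2Space G := S.exp.symm.isEmbedding.t2Space
  have hφm : Measurable φ := measurable_of_continuousOn_compl_singleton 1 hφc
  have hψm : Measurable ψ := measurable_of_continuousOn_compl_singleton 1 hψc
  have hq : (1 : ℝ≥0∞) < residueCard K := by exact_mod_cast hK.one_lt_residueCard
  have hq' : (residueCard K : ℝ≥0∞) ≠ ⊤ := ENNReal.natCast_ne_top _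
  have hr0 : 0 < r := hr.pos
  have hr0' : 0 < r' := hr.symm.pos
  have hs0 : 0 < s := hr0.trans_le hrs
  have hinv := hr.inv_add_inv_eq_one
  set q : ℝ≥0∞ := (residueCard K : ℝ≥0∞)
  set Q : ℝ := (S.toLieGradation.homDim : ℝ)
  -- The common exponent: the integrals of `φ` over the shells decay like `q^{-nts}`, and `hcrit`
  -- makes those of `ψ^{1-r'}` grow like `q^{ntr'}`.
  set t : ℝ := (Q - α) / s with ht
  have ht0 : 0 < t := div_pos (by linarith) hs0
  set W : ℝ≥0∞ := ∑' j : ℤ, (if 0 < j then q ^ (-(j * t) : ℝ) else 0)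
  set I : ℝ≥0∞ := ∫⁻ x in shell S b 0, ENNReal.ofReal (ψ x) ^ (1 - r') ∂μ with hI
  set P : ℝ≥0∞ := ∫⁻ x in shell S b 0, ENNReal.ofReal (φ x) ∂μ with hP
  have hPtop : P ≠ ⊤ := setLIntegral_ne_top_of_continuousOn hK S b μ hφc
  have hWtop : W ≠ ⊤ := tsum_geometric_pos_ne_top hq ht0
  have hCtop : W * I ^ (1 / r') * P ^ (1 / s) ≠ ⊤ :=
    ENNReal.mul_ne_top (ENNReal.mul_ne_top hWtop (ENNReal.rpow_ne_top_of_nonneg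
      (by positivity) hψ)) (ENNReal.rpow_ne_top_of_nonneg (by positivity) hPtop)
  refine ⟨(W * I ^ (1 / r') * P ^ (1 / s)).toNNReal, fun f hf => ?_⟩
  rw [ENNReal.coe_toNNReal hCtop]
  have hfm : AEMeasurable (fun x => ENNReal.ofReal (f x)) μ := hf.ennreal_ofReal
  have hΦ : ∀ n, ∫⁻ x in shell S b n, ENNReal.ofReal (φ x) ∂μ = q ^ (-(n * (t * s)) : ℝ) * P := by
    intro n
    rw [setLIntegral_shell hK S b μ hϖ hφm.ennreal_ofReal
      (fun n x hx => hφh.ofReal_dil hK hϖ n hx)]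
    congr 2
    rw [ht, div_mul_cancel₀ _ hs0.ne']
    ring
  have hΨ : ∀ n, ∫⁻ x in shell S b n, ENNReal.ofReal (ψ x) ^ (1 - r') ∂μ =
      q ^ (n * (t * r') : ℝ) * I := by
    intro n
    rw [setLIntegral_shell hK S b μ hϖ (d := (r' - 1) * β) (hψm.ennreal_ofReal.pow_const _)]
    · congr 2
      -- The critical relation enters only here.
      have h1 : t = β / r - Q / r' := by
        have : (Q - α) / s = - ((α - Q) / s) := by ring
        rw [ht, this, hcrit]
        ring
      have h2 : r' / r = r' - 1 := by
        have h3 : r' * r'⁻¹ = 1 := mul_inv_cancel₀ hr0'.ne'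
        rw [div_eq_mul_inv, show r⁻¹ = 1 - r'⁻¹ by linarith]
        linarith
      have h4 : t * r' = (r' - 1) * β - Q := by
        rw [h1, sub_mul, div_mul_cancel₀ _ hr0'.ne', ← h2]
        ring
      rw [h4]
    · intro n x hx
      rw [hψh.ofReal_dil hK hϖ n hx, ENNReal.mul_rpow_of_ne_top (ENNReal.rpow_ne_top_of_ne_zero
        (zero_lt_one.trans hq).ne' hq') ENNReal.ofReal_ne_top, ← ENNReal.rpow_mul]
      congr 2
      ring
  set A : ℤ → ℝ≥0∞ := fun m =>
    ∫⁻ x in shell S b m, ENNReal.ofReal (f x) ^ r * ENNReal.ofReal (ψ x) ∂μ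
  have hF : ∀ m : ℤ, ∫⁻ x in shell S b m, ENNReal.ofReal (f x) ∂μ ≤
      q ^ (m * t : ℝ) * (I ^ (1 / r') * A m ^ (1 / r)) := by
    intro m
    have hqm : q ^ (m * (t * r') : ℝ) ≠ ⊤ :=
      ENNReal.rpow_ne_top_of_ne_zero (zero_lt_one.trans hq).ne' hq'
    refine (setLIntegral_le_weighted hr hfm.restrict hψm.ennreal_ofReal
      (fun _ => ENNReal.ofReal_ne_top) (by rw [hΨ]; exact ENNReal.mul_ne_top hqm hψ)).trans_eq ?_
    rw [hΨ, ENNReal.mul_rpow_of_nonneg _ _ (by positivity), ← ENNReal.rpow_mul,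
      show (m * (t * r') * (1 / r') : ℝ) = m * t by field_simp]
    ring
  rw [lintegral_hardy_eq_tsum hK S b μ hμ _ hφm.ennreal_ofReal, lintegral_eq_tsum_shell hK S b μ hμ]
  simp_rw [hΦ, ← mul_assoc]
  rw [ENNReal.tsum_mul_right, ENNReal.mul_rpow_of_nonneg _ _ (by positivity : 0 ≤ 1 / s)]
  calc _ ≤ (W ^ s * (∑' m, (I ^ (1 / r') * A m ^ (1 / r)) ^ r) ^ (s / r)) ^ (1 / s) *
        P ^ (1 / s) := by
        gcongr
        simpa only [← mul_assoc] using tsum_hardy_le hq hq' hr hrs hF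
    _ = _ := by
        have hA : ∀ m, (I ^ (1 / r') * A m ^ (1 / r)) ^ r = (I ^ (1 / r')) ^ r * A m := fun m => by
          rw [ENNReal.mul_rpow_of_nonneg _ _ hr0.le, ← ENNReal.rpow_mul (A m),
            one_div_mul_cancel hr0.ne', ENNReal.rpow_one]
        simp_rw [hA]
        rw [ENNReal.tsum_mul_left, ENNReal.mul_rpow_of_nonneg _ _ (by positivity),
          ← ENNReal.rpow_mul, ← ENNReal.rpow_mul, mul_one_div_cancel hs0.ne', ENNReal.rpow_one,
          show s / r * (1 / s) = 1 / r by field_simp,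
          ENNReal.mul_rpow_of_nonneg _ _ (by positivity), ← ENNReal.rpow_mul (I ^ (1 / r')),
          mul_one_div_cancel hr0.ne', ENNReal.rpow_one]
        ring

include hK hμ hr hrs hφc hψc hφh hψh in
/-- The weighted Hardy inequality forces the critical homogeneity. -/
theorem critical_of_hardy (hφ0 : ∀ x, 0 ≤ φ x) (hφ : ∃ x, x ≠ 1 ∧ φ x ≠ 0) {C : ℝ≥0}
    (hC : ∀ f : G → ℝ, AEMeasurable f μ → (∀ᵐ x ∂μ, 0 ≤ f x) →
      (∫⁻ x, (∫⁻ z in (gball S b μ (gnorm S b μ x))ᶜ, ENNReal.ofReal (f z) ∂μ) ^ s *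
          ENNReal.ofReal (φ x) ∂μ) ^ (1 / s) ≤
        C * (∫⁻ x, ENNReal.ofReal (f x) ^ r * ENNReal.ofReal (ψ x) ∂μ) ^ (1 / r)) :
    (α - S.toLieGradation.homDim) / s = S.toLieGradation.homDim / r' - β / r := by
  obtain ⟨ϖ, hϖ⟩ := hK.exists_uniformizer
  have : T2Space G := S.exp.symm.isEmbedding.t2Space
  have hφm : Measurable φ := measurable_of_continuousOn_compl_singleton 1 hφc
  have hψm : Measurable ψ := measurable_of_continuousOn_compl_singleton 1 hψc
  have hq : (1 : ℝ≥0∞) < residueCard K := by exact_mod_cast hK.one_lt_residueCard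
  have hq0 := (zero_lt_one.trans hq).ne'
  have hq' : (residueCard K : ℝ≥0∞) ≠ ⊤ := ENNReal.natCast_ne_top _
  have hr0 : 0 < r := hr.pos
  have hs0 : 0 < s := hr0.trans_le hrs
  have hinv := hr.inv_add_inv_eq_one
  set q : ℝ≥0∞ := (residueCard K : ℝ≥0∞)
  set Q : ℝ := (S.toLieGradation.homDim : ℝ)
  set P : ℝ≥0∞ := ∫⁻ x in shell S b 0, ENNReal.ofReal (φ x) ∂μ
  set R : ℝ≥0∞ := ∫⁻ x in shell S b 0, ENNReal.ofReal (ψ x) ∂μ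
  set M : ℝ≥0∞ := μ (shell S b 0)
  have hPtop : P ≠ ⊤ := setLIntegral_ne_top_of_continuousOn hK S b μ hφc
  have hRtop : R ≠ ⊤ := setLIntegral_ne_top_of_continuousOn hK S b μ hψc
  have hMtop : M ≠ ⊤ := (isCompact_shell S b hK 0).measure_ne_top
  have hP0 : P ≠ 0 := setLIntegral_ne_zero_of_ne_zero hK S b μ hφ0 hφc hφh hφ
  have hM0 : M ≠ 0 := measure_shell_zero_ne_zero hK S b μ
  have hΦ : ∀ n, ∫⁻ x in shell S b n, ENNReal.ofReal (φ x) ∂μ = q ^ (n * (α - Q) : ℝ) * P := by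
    intro n
    rw [setLIntegral_shell hK S b μ hϖ hφm.ennreal_ofReal
      (fun n x hx => hφh.ofReal_dil hK hϖ n hx), neg_neg]
  have hΨ : ∀ n, ∫⁻ x in shell S b n, ENNReal.ofReal (ψ x) ∂μ = q ^ (n * (-β - Q) : ℝ) * R :=
    setLIntegral_shell hK S b μ hϖ hψm.ennreal_ofReal
      (fun n x hx => hψh.ofReal_dil hK hϖ n hx)
  have hE : ∀ n, μ (shell S b n) = q ^ (n * (0 - Q) : ℝ) * M := by
    intro n
    have := setLIntegral_shell hK S b μ hϖ (measurable_one (α := ℝ≥0∞)) (d := 0)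
      (fun n x _ => by simp) n
    simpa using this
  -- The test function is the indicator of shell `m`. Only the outer term `m + 1` is kept: the inner
  -- sum runs over strictly smaller indices, so this is the first shell whose inner integral sees
  -- shell `m`.
  have key : ∀ m : ℤ, q ^ (m * (0 - Q) : ℝ) * M *
      (q ^ ((m + 1) * (α - Q) : ℝ) * P) ^ (1 / s) ≤ C * (q ^ (m * (-β - Q) : ℝ) * R) ^ (1 / r) := by
    intro m
    have hEm := measurableSet_shell S b hK m
    have h1 := hC ((shell S b m).indicator 1) (measurable_one.indicator hEm).aemeasurable
      (Filter.Eventually.of_forall fun x => Set.indicator_nonneg (fun _ _ => zero_le_one) x)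
    have h2 : ∀ x, ENNReal.ofReal ((shell S b m).indicator (1 : G → ℝ) x) =
        (shell S b m).indicator (1 : G → ℝ≥0∞) x := fun x => by
      by_cases hx : x ∈ shell S b m <;> simp [hx]
    have h3 : ∀ x, (shell S b m).indicator (1 : G → ℝ≥0∞) x ^ r * ENNReal.ofReal (ψ x) =
        (shell S b m).indicator (fun x => ENNReal.ofReal (ψ x)) x := fun x => by
      by_cases hx : x ∈ shell S b m <;> simp [hx, hr0]
    simp_rw [h2, h3] at h1
    rw [lintegral_indicator hEm, hΨ, lintegral_hardy_eq_tsum hK S b μ hμ _ hφm.ennreal_ofReal] at h1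
    refine le_trans ?_ h1
    have h4 : q ^ (m * (0 - Q) : ℝ) * M ≤ ∑' k, if k < m + 1 then
        ∫⁻ z in shell S b k, (shell S b m).indicator (1 : G → ℝ≥0∞) z ∂μ else 0 := by
      refine le_trans (le_of_eq ?_) (ENNReal.le_tsum m)
      rw [if_pos (lt_add_one m), lintegral_indicator_one hEm, Measure.restrict_apply hEm,
        Set.inter_self, hE]
    calc q ^ (m * (0 - Q) : ℝ) * M * (q ^ ((m + 1) * (α - Q) : ℝ) * P) ^ (1 / s)
        = ((q ^ (m * (0 - Q) : ℝ) * M) ^ s * (q ^ ((m + 1) * (α - Q) : ℝ) * P)) ^ (1 / s) := by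
          rw [ENNReal.mul_rpow_of_nonneg (_ ^ s) _ (by positivity : 0 ≤ 1 / s), ← ENNReal.rpow_mul,
            mul_one_div_cancel hs0.ne', ENNReal.rpow_one]
      _ ≤ _ := by
          refine ENNReal.rpow_le_rpow ?_ (by positivity)
          refine le_trans ?_ (ENNReal.le_tsum (m + 1))
          rw [hΦ]
          push_cast
          gcongr
  -- The factors on the left of `key` that do not depend on `m`; the power of `q` comes from the
  -- shift `m + 1`.
  set D : ℝ≥0∞ := M * (q ^ ((α - Q) / s) * P ^ (1 / s)) with hD
  have hqtop : ∀ x : ℝ, q ^ x ≠ ⊤ := fun x => ENNReal.rpow_ne_top_of_ne_zero hq0 hq'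
  have hqne : ∀ x : ℝ, q ^ x ≠ 0 := fun x => (ENNReal.rpow_pos (pos_iff_ne_zero.2 hq0) hq').ne'
  have hD0 : D ≠ 0 := mul_ne_zero hM0 (mul_ne_zero (hqne _)
    (ENNReal.rpow_pos (pos_iff_ne_zero.2 hP0) hPtop).ne')
  have hDtop : D ≠ ⊤ := ENNReal.mul_ne_top hMtop (ENNReal.mul_ne_top (hqtop _)
    (ENNReal.rpow_ne_top_of_nonneg (by positivity) hPtop))
  -- Multiplying `key` by `q^{m(β+Q)/r}` removes `m` from the right side. As `Q / r' = Q - Q / r`,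
  -- the vanishing of this exponent is the critical relation.
  have hδ : (α - Q) / s - Q + (β + Q) / r = 0 := by
    refine eq_zero_of_rpow_le hq (M := C * R ^ (1 / r) / D) (ENNReal.div_ne_top
      (ENNReal.mul_ne_top ENNReal.coe_ne_top (ENNReal.rpow_ne_top_of_nonneg (by positivity) hRtop))
      hD0) fun m => ?_
    rw [ENNReal.le_div_iff_mul_le (Or.inl hD0) (Or.inl hDtop)]
    have h5 := mul_le_mul_right (key m) (q ^ (m * ((β + Q) / r) : ℝ))
    rw [ENNReal.mul_rpow_of_nonneg _ _ (by positivity), ENNReal.mul_rpow_of_nonneg _ R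
      (by positivity), ← ENNReal.rpow_mul, ← ENNReal.rpow_mul] at h5
    calc _ = q ^ (m * ((β + Q) / r) : ℝ) * (q ^ (m * (0 - Q) : ℝ) * M *
          (q ^ ((m + 1) * (α - Q) * (1 / s) : ℝ) * P ^ (1 / s))) := by
          rw [hD, show (m * ((α - Q) / s - Q + (β + Q) / r) : ℝ) =
            m * ((β + Q) / r) + (m * (0 - Q) + m * ((α - Q) / s)) by ring,
            show ((m + 1) * (α - Q) * (1 / s) : ℝ) = m * ((α - Q) / s) + (α - Q) / s by ring,
            ENNReal.rpow_add _ _ hq0 hq', ENNReal.rpow_add _ _ hq0 hq',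
            ENNReal.rpow_add _ _ hq0 hq']
          ring
      _ ≤ _ := h5
      _ = (q ^ (m * ((β + Q) / r) : ℝ) * q ^ (m * (-β - Q) * (1 / r) : ℝ)) *
          (C * R ^ (1 / r)) := by ring
      _ = C * R ^ (1 / r) := by
          rw [← ENNReal.rpow_add _ _ hq0 hq',
            show (m * ((β + Q) / r) + m * (-β - Q) * (1 / r) : ℝ) = 0 by ring,
            ENNReal.rpow_zero, one_mul]
  have h6 : Q / r' = Q - Q / r := by
    rw [div_eq_mul_inv, show r'⁻¹ = 1 - r⁻¹ by linarith]
    ring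
  rw [h6]
  rw [add_div] at hδ
  linarith

end Hardy

end GradedHardy

theorem mainTheorem9 {K L G ι : Type*} [NontriviallyNormedField K] [IsUltrametricDist K]
    [LocallyCompactSpace K] (hK : IsNormalizedAbs K)
    [LieRing L] [LieAlgebra K L] [TopologicalSpace L] [T2Space L] [IsTopologicalAddGroup L]
    [ContinuousSMul K L]
    [Group G] [TopologicalSpace G] [IsTopologicalGroup G] [MeasurableSpace G] [BorelSpace G]
    (S : GradedLieGroup K L G) [Fintype ι] (b : AdaptedBasis S.toLieGradation ι)
    (μ : Measure G) [μ.IsHaarMeasure] (hμ : μ (filt S b 0) = 1)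
    (Q : ℝ) (hQ : Q = (S.toLieGradation.homDim : ℝ))
    (α β r r' s : ℝ) (hr : 1 < r) (hrs : r ≤ s) (hr' : 1 / r + 1 / r' = 1)
    (hα : α < Q) (hβ : Q / (r' - 1) < β)
    (φ ψ : G → ℝ) (hφ0 : ∀ x, 0 ≤ φ x) (hψ0 : ∀ x, 0 ≤ ψ x)
    (hφc : ContinuousOn φ {1}ᶜ) (hψc : ContinuousOn ψ {1}ᶜ)
    (hφh : S.IsHomogeneous φ (-α)) (hψh : S.IsHomogeneous ψ β)
    (hφ : ∃ x, x ≠ 1 ∧ φ x ≠ 0)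
    (hψ : ∫⁻ x in filt S b 0 \ filt S b 1, ENNReal.ofReal (ψ x) ^ (1 - r') ∂μ < ⊤) :
    (∃ C : NNReal, ∀ f : G → ℝ, AEMeasurable f μ → (∀ᵐ x ∂μ, 0 ≤ f x) →
      (∫⁻ x, (∫⁻ z in (gball S b μ (gnorm S b μ x))ᶜ, ENNReal.ofReal (f z) ∂μ) ^ s *
          ENNReal.ofReal (φ x) ∂μ) ^ (1 / s) ≤
        C * (∫⁻ x, ENNReal.ofReal (f x) ^ r * ENNReal.ofReal (ψ x) ∂μ) ^ (1 / r)) ↔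
      (α - Q) / s = Q / r' - β / r := by
  -- A point off the identity exists because `φ` does not vanish there identically; nontriviality in
  -- turn gives `Q > 0`.
  have : Nontrivial G := let ⟨x, hx, _⟩ := hφ; ⟨x, 1, hx⟩
  subst hQ
  have hconj : r.HolderConjugate r' := Real.holderConjugate_iff.2 ⟨hr, by simpa using hr'⟩
  constructor
  · rintro ⟨C, hC⟩
    exact critical_of_hardy hK S b μ hμ hconj hrs hφc hψc hφh hψh hφ0 hφ hC
  · intro hcrit
    obtain ⟨C, hC⟩ := exists_hardy_const hK S b μ hμ hconj hrs hφc hψc hφh hψh hα hψ.ne hcrit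
    exact ⟨C, fun f hf _ => hC f hf⟩
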